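/- **Profiles.** Consider real functions $r>0$, $a$, $k$ on $(0,1)$ with $$\dot k=r,\qquad \dot r=-ra,\qquad \dot a=-\Big(a^2+\tfrac{32}{9}r^3\Big),\qquad \lim_{t\to1}r(t)=\infty ,$$ and put $l(t)=\dfrac{3}{4r(t)}$. The triple is called a *planning profile* if moreover $\lim_{t\to0}r(t)=\infty$ and $\lim_{t\to 0}k(t)=0$. For $\eta>0$ it is called an *$\eta$-profile* if $r,a,k$ extend continuously to $[0,1)$ with $r(0)>0$, $a(0)=1/\eta$, $k(0)=0$. **Explicit solutions.** Given a profile let $$\rho(x,t)=r(t)\Big(1-\frac{x^2}{l(t)^2}\Big)_+,\qquad u(x,t)=k(t)+\tfrac12a(t)x^2\quad\text{for }|x|\le l(t).$$ For $|x|>l(t)$, if there is $t_0\in(0,t)$ with $|x|=l(t_0)+(t-t_0)\dot l(t_0)$, let $u(x,t)=u(l(t_0),t_0)+\frac{(|x|-l(t_0))^2}{2(t-t_0)}$; if there is none (which for $0<t<1$ happens only for $\eta$-profiles) let $u(x,t)=\frac{x^2}{2(t+\eta)}$. For a planning profile write $(\bar\rho,\bar u)$ for $(\rho,u)$, with $\bar\rho(\cdot,0)=\bar\rho(\cdot,1)=\delta_0$.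 These are the explicit solutions of $$\partial_t u+\tfrac12(\partial_xu)^2=\rho,\quad \partial_t\rho+\partial_x(\rho\,\partial_xu)=0,\quad \rho(\cdot,0)=\rho(\cdot,1)=\delta_0,\ u(0,0)=0 .$$ For an $\eta$-profile write $(\bar\rho_\eta,\bar u_\eta)$, with $\bar\rho_\eta(\cdot,1)=\delta_0$; they solve the same equations with $u(x,0)=x^2/2\eta$, $\rho(\cdot,1)=\delta_0$. **Variational problems.** Let $\mathcal P_2$ be the space of probability measures on $\mathbb R$ with finite second moment, with the topology of the quadratic Wasserstein distance. $\mathcal A_\eta$ is the set of pairs $(\rho,\beta)$ with $\rho\in C([0,1];\mathcal P_2)\cap L^2(\mathbb R\times(0,1))$, $\beta\in L^{4/3}(\mathbb R\times(0,1))$, $\partial_t\rho+\partial_x\beta=0$ in the sense of distributions in $\mathbb R\times(0,1)$, $\rho(\cdot,1)=\delta_0$, $|\beta|\le A\rho^{1/2}$ for some $A\in L^2(\mathbb R\times(0,1))$, and $\beta=0$ a.e. in $\{\rho=0\}$. $\mathcal A$ is the set of those pairs that satisfy in addition $\rho(\cdot,0)=\delta_0$. With $\beta^2/\rho=0$ where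 $\rho=0$, let $$\bar I(\rho,\beta)=\int_0^1\!\!\int_{\mathbb R}\tfrac12\Big[\rho^2+\frac{\beta^2}{\rho}\Big]dx\,dt,\qquad \bar I_\eta(\rho,\beta)=\bar I(\rho,\beta)+\int_{\mathbb R}\frac{x^2}{2\eta}\,\rho(dx,0).$$ **Lemma.** For every $\eta>0$ an $\eta$-profile exists, and for every $\eta$-profile the pair $(\bar\rho_\eta,\bar\rho_\eta\,\partial_x\bar u_\eta)$ lies in $\mathcal A_\eta$ and is the unique minimizer of $\bar I_\eta$ over $\mathcal A_\eta$. A planning profile exists, and for every planning profile the pair $(\bar\rho,\bar\rho\,\partial_x\bar u)$ lies in $\mathcal A$ and is the unique minimizer of $\bar I$ over $\mathcal A$. Uniqueness means: $\rho$ is the same for every $t\in[0,1]$ as a measure, hence a.e. as a density, and $\beta$ is the same a.e. -/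

import Mathlib

open MeasureTheory Set Filter Topology
open scoped ContDiff ENNReal

noncomputable section

namespace Planning

/-! ### The explicit solutions

Points of space-time are written `p = (x, t)`. -/

/-- The half width `l(t)` of the support, fixed by the unit mass condition `r(t) l(t) = 3/4`. -/
def halfWidth (r : ℝ → ℝ) (t : ℝ) : ℝ := 3 / (4 * r t)

/-- The equations `k' = r`, `r' = - r a`, `a' = - (a² + (32/9) r³)` on `(0,1)`, with `r > 0`.
They say that `r (1 - x²/l²)` and `k + a x²/2` solve the Hamilton-Jacobi and the continuity
equation in the domain `|x| < l(t)`. -/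
structure IsProfile (r a k : ℝ → ℝ) : Prop where
  pos : ∀ t ∈ Ioo (0 : ℝ) 1, 0 < r t
  deriv_k : ∀ t ∈ Ioo (0 : ℝ) 1, HasDerivAt k (r t) t
  deriv_r : ∀ t ∈ Ioo (0 : ℝ) 1, HasDerivAt r (-(r t * a t)) t
  deriv_a : ∀ t ∈ Ioo (0 : ℝ) 1, HasDerivAt a (-((a t) ^ 2 + 32 / 9 * (r t) ^ 3)) t
  r_one : Tendsto r (𝓝[<] 1) atTop

/-- Profiles of the planning problem: the density starts and ends as a Dirac mass
(`r → ∞` at both ends) and `u(0,0) = 0`. -/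
structure IsPlanningProfile (r a k : ℝ → ℝ) : Prop extends IsProfile r a k where
  r_zero : Tendsto r (𝓝[>] 0) atTop
  k_zero : Tendsto k (𝓝[>] 0) (𝓝 0)

/-- Profiles of the regularized system: `u(x,0) = x²/(2η)` and the density ends as a Dirac
mass. -/
structure IsRegularizedProfile (η : ℝ) (r a k : ℝ → ℝ) : Prop extends IsProfile r a k where
  pos_zero : 0 < r 0
  cont_r : ContinuousOn r (Ico 0 1)
  cont_a : ContinuousOn a (Ico 0 1)
  cont_k : ContinuousOn k (Ico 0 1)
  a_zero : a 0 = 1 / η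
  k_zero : k 0 = 0

/-- The density `r(t) (1 - (x/l(t))²)₊`. -/
def rhoBar (r : ℝ → ℝ) (p : ℝ × ℝ) : ℝ :=
  r p.2 * max (1 - (p.1 / halfWidth r p.2) ^ 2) 0

/-- `s ∈ (0,t)` is a foot for `(x,t)`: the tangent line at `(l(s), s)` to the curve
`|x| = l` passes through `(|x|, t)`. -/
def IsFoot (r : ℝ → ℝ) (p : ℝ × ℝ) (s : ℝ) : Prop :=
  s ∈ Ioo 0 p.2 ∧ |p.1| = halfWidth r s + (p.2 - s) * deriv (halfWidth r) s

open Classical in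
/-- The value function: `k + a x²/2` in `|x| ≤ l(t)`; outside, it is transported along the
tangent line from the boundary point `(l(s), s)`; at the points that no tangent line reaches
(there are none with `0 < t < 1` in the planning problem) it is given by `far`. -/
def valueFn (far : ℝ × ℝ → ℝ) (r a k : ℝ → ℝ) (p : ℝ × ℝ) : ℝ :=
  if |p.1| ≤ halfWidth r p.2 then k p.2 + a p.2 * p.1 ^ 2 / 2
  else if h : ∃ s, IsFoot r p s then
    (k h.choose + a h.choose * (halfWidth r h.choose) ^ 2 / 2)
      + (|p.1| - halfWidth r h.choose) ^ 2 / (2 * (p.2 - h.choose))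
  else far p

/-- The value function of the planning problem. -/
def uBar (r a k : ℝ → ℝ) : ℝ × ℝ → ℝ := valueFn (fun _ => 0) r a k

/-- The value function of the regularized system; the straight characteristics issued at time
`0` from `|x| ≥ l(0)` carry the value `x²/(2(t+η))`. -/
def uBarEta (η : ℝ) (r a k : ℝ → ℝ) : ℝ × ℝ → ℝ :=
  valueFn (fun p => p.1 ^ 2 / (2 * (p.2 + η))) r a k

/-- The flux `ρ ∂ₓu`. -/
def flux (ρ u : ℝ × ℝ → ℝ) (p : ℝ × ℝ) : ℝ := ρ p * deriv (fun x => u (x, p.2)) p.1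

/-! ### The variational problems -/

/-- Lebesgue measure on the strip `ℝ × (0,1)`. -/
def stripMeasure : Measure (ℝ × ℝ) := volume.restrict (univ ×ˢ Ioo (0 : ℝ) 1)

/-- A pair `(ρ, β)`: the curve of measures `t ↦ ρ(·,t)` on `[0,1]`, its space-time density, and
the flux. -/
structure Pair where
  /-- the measure `ρ(·,t)` -/
  curve : ℝ → Measure ℝ
  /-- the density of `ρ` in `ℝ × (0,1)` -/
  density : ℝ × ℝ → ℝ
  /-- the flux `β` -/
  beta : ℝ × ℝ → ℝ

/-- Equality of pairs: same measures on `[0,1]`, same density and flux almost everywhere. -/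
def Pair.Same (c d : Pair) : Prop :=
  (∀ t ∈ Icc (0 : ℝ) 1, c.curve t = d.curve t) ∧
    c.density =ᵐ[stripMeasure] d.density ∧ c.beta =ᵐ[stripMeasure] d.beta

/-- `μ ∈ C([0,1]; 𝒫₂)`: probability measures with finite second moment, continuous in time
for the topology of `𝒫₂` (that of the quadratic Wasserstein distance), which is convergence
against all continuous functions of at most quadratic growth. -/
structure ContinuousInP2 (μ : ℝ → Measure ℝ) : Prop where
  prob : ∀ t ∈ Icc (0 : ℝ) 1, IsProbabilityMeasure (μ t)
  moment : ∀ t ∈ Icc (0 : ℝ) 1, Integrable (fun x : ℝ => x ^ 2) (μ t)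
  cont : ∀ f : ℝ → ℝ, Continuous f → (∃ C : ℝ, ∀ x, |f x| ≤ C * (1 + x ^ 2)) →
    ContinuousOn (fun t => ∫ x, f x ∂(μ t)) (Icc 0 1)

/-- `∂ₜρ + ∂ₓβ = 0` in the sense of distributions in `ℝ × (0,1)`. -/
def ContinuityEq (ρ β : ℝ × ℝ → ℝ) : Prop :=
  ∀ φ : ℝ × ℝ → ℝ, ContDiff ℝ ∞ φ → HasCompactSupport φ →
    tsupport φ ⊆ univ ×ˢ Ioo (0 : ℝ) 1 →
    ∫ p, (ρ p * fderiv ℝ φ p (0, 1) + β p * fderiv ℝ φ p (1, 0)) ∂stripMeasure = 0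

/-- The admissible class of the regularized problem. -/
structure AdmissibleEta (c : Pair) : Prop where
  curve_cont : ContinuousInP2 c.curve
  density_nonneg : ∀ᵐ p ∂stripMeasure, 0 ≤ c.density p
  curve_eq : ∀ᵐ t ∂(volume.restrict (Ioo (0 : ℝ) 1)),
    c.curve t = volume.withDensity (fun x => ENNReal.ofReal (c.density (x, t)))
  density_memLp : MemLp c.density 2 stripMeasure
  beta_memLp : MemLp c.beta (4 / 3) stripMeasure
  continuityEq : ContinuityEq c.density c.beta
  terminal : c.curve 1 = Measure.dirac 0
  bound : ∃ A : ℝ × ℝ → ℝ, MemLp A 2 stripMeasure ∧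
    ∀ᵐ p ∂stripMeasure, |c.beta p| ≤ A p * √(c.density p)
  beta_zero : ∀ᵐ p ∂stripMeasure, c.density p = 0 → c.beta p = 0

/-- The admissible class of the planning problem. -/
structure Admissible (c : Pair) : Prop extends AdmissibleEta c where
  initial : c.curve 0 = Measure.dirac 0

/-- `∫∫ ½ (ρ² + β²/ρ)`, with `β²/ρ = 0` where `ρ = 0`. The integrand is integrable for every
admissible pair. -/
def energy (c : Pair) : ℝ :=
  ∫ p, 1 / 2 * ((c.density p) ^ 2 + (c.beta p) ^ 2 / c.density p) ∂stripMeasure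

/-- The energy with the penalization `∫ ρ(x,0) x²/(2η)`. -/
def energyEta (η : ℝ) (c : Pair) : ℝ :=
  energy c + ∫ x, x ^ 2 / (2 * η) ∂(c.curve 0)

/-- `c` minimizes `J` in the class `S` and is the only minimizer. -/
def IsUniqueMinimizer (S : Pair → Prop) (J : Pair → ℝ) (c : Pair) : Prop :=
  S c ∧ (∀ d, S d → J c ≤ J d) ∧ ∀ d, S d → (∀ e, S e → J d ≤ J e) → d.Same c

open Classical in
/-- The pair `(ρ, ρ ∂ₓu)` of the planning problem, with `ρ(·,0) = ρ(·,1) = δ`. -/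
def planningPair (r a k : ℝ → ℝ) : Pair where
  curve t := if t ∈ Ioo (0 : ℝ) 1 then
      volume.withDensity (fun x => ENNReal.ofReal (rhoBar r (x, t)))
    else Measure.dirac 0
  density := rhoBar r
  beta := flux (rhoBar r) (uBar r a k)

open Classical in
/-- The pair `(ρ, ρ ∂ₓu)` of the regularized system, with `ρ(·,1) = δ`. -/
def regularizedPair (η : ℝ) (r a k : ℝ → ℝ) : Pair where
  curve t := if t ∈ Ico (0 : ℝ) 1 then
      volume.withDensity (fun x => ENNReal.ofReal (rhoBar r (x, t)))
    else Measure.dirac 0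
  density := rhoBar r
  beta := flux (rhoBar r) (uBarEta η r a k)

end Planning

end

/-! Minimality is proved by calibration. Extend `v = k + a x²/2` to all of `ℝ × (0,1)`. The profile
equations give `∂ₜv + ½(∂ₓv)² = r (1 - x²/l²)`, which is at most `ρ̄`, with equality on the support
of `ρ̄`. Completing squares, for every competitor `(ρ, β)`, `½(ρ² + β²/ρ) + ½ρ̄² - (ρ ∂ₜv + β ∂ₓv) =
½(ρ - ρ̄)² + ½(β - ρ a x)²/ρ + ρ(ρ̄ - r(1 - x²/l²)) ≥ 0`. The right side is `Pair.gap`; it vanishes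
identically for the explicit pair. Since `ρ̄` vanishes outside `|x| < l`, the explicit flux is `ρ̄ a
x`, and the continuation of `u` along tangent lines plays no role.

Since `v` is quadratic in `x`, integrating `ρ ∂ₜv + β ∂ₓv` over a slab only requires the mass and
the second moment `m` of `ρ(·,t)`, and yields the increment of `k + ½ a m`. For this the continuity
equation is tested with `x² θ(t)` (`AdmissibleEta.moment_sub`).

The end times need care, because `a` may blow up there. The half width satisfies `l'' = -(3/2)/l²`,
hence is concave, and `|a|` is at most `1/t`, respectively `1/(1-t)`, up to a constant. Near a time
when the measure is a Dirac mass at the origin, `m` is little-o of the elapsed time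
(`AdmissibleEta.exists_moment_le`). So `a m` tends to `0` there; in the regularized problem it tends
to `m(0)/η` at time `0`, which is the penalization. Thus the integral of the gap is the excess of
the functional over its value at the explicit pair (`IsProfile.tendsto_integral_gap`). A second
minimizer has zero gap almost everywhere, which forces the same density and flux, and then the same
measures by continuity in time.

Existence comes from integrating `l'' = -(3/2)/l²`, the radial Kepler problem, by cycloids `l = c(1
- cos Θ)`, `δ(Θ - sin Θ) = t + const`. The planning profile is a full arch; for an `η`-profile the
initial angle is found by the intermediate value theorem. -/

noncomputable section

namespace Planning

/-! ### Weak derivatives on an interval -/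

/-- Product rule for a primitive of an integrable function and a `C¹` function. -/
theorem mul_sub_mul_eq_integral {s t : ℝ} {f b a a' : ℝ → ℝ} (hst : s ≤ t)
    (hb : IntervalIntegrable b volume s t)
    (hf : ∀ x ∈ Icc s t, f x - f s = ∫ τ in s..x, b τ)
    (ha : ∀ x ∈ Icc s t, HasDerivAt a (a' x) x) (ha' : ContinuousOn a' (Icc s t)) :
    a t * f t - a s * f s = ∫ τ in s..t, (a' τ * f τ + a τ * b τ) := by
  have hu : uIcc s t = Icc s t := uIcc_of_le hst
  have hia : IntervalIntegrable a' volume s t :=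
    ContinuousOn.intervalIntegrable (by rwa [hu])
  have hca : ContinuousOn a (Icc s t) := fun x hx => (ha x hx).continuousAt.continuousWithinAt
  have hcf : ContinuousOn f (Icc s t) := by
    have h1 : ContinuousOn (fun x => ∫ τ in s..x, b τ) (Icc s t) := by
      have := intervalIntegral.continuousOn_primitive_interval' hb left_mem_uIcc
      rwa [hu] at this
    refine (h1.add (continuousOn_const (c := f s))).congr fun x hx => ?_
    rw [Pi.add_apply, ← hf x hx]
    ring
  have haF : ∀ x ∈ Icc s t, a x - a s = ∫ τ in s..x, a' τ := by
    intro x hx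
    rw [intervalIntegral.integral_eq_sub_of_hasDerivAt]
    · intro y hy
      rw [uIcc_of_le hx.1] at hy
      exact ha y ⟨hy.1, hy.2.trans hx.2⟩
    · refine hia.mono_set ?_
      rw [uIcc_of_le hx.1, hu]
      exact Icc_subset_Icc_right hx.2
  have hF := hia.absolutelyContinuousOnInterval_intervalIntegral (c := s) left_mem_uIcc
  have hG := hb.absolutelyContinuousOnInterval_intervalIntegral (c := s) left_mem_uIcc
  have key := hF.integral_deriv_mul_eq_sub hG
  rw [intervalIntegral.integral_same, zero_mul, sub_zero,
    ← haF t ⟨hst, le_rfl⟩, ← hf t ⟨hst, le_rfl⟩] at key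
  -- The two primitives are `a - a s` and `f - f s`; the subtracted terms account for these
  -- constants.
  have e1 : ∫ x in s..t, (deriv (fun x => ∫ v in s..x, a' v) x * (∫ v in s..x, b v)
      + (∫ v in s..x, a' v) * deriv (fun x => ∫ v in s..x, b v) x)
      = ∫ x in s..t, ((a' x * f x + a x * b x) - (f s * a' x + a s * b x)) := by
    apply intervalIntegral.integral_congr_ae
    filter_upwards [hia.ae_hasDerivAt_integral, hb.ae_hasDerivAt_integral] with x h1 h2 hx
    have hx' := uIoc_subset_uIcc hx
    rw [(h1 hx' s left_mem_uIcc).deriv, (h2 hx' s left_mem_uIcc).deriv]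
    rw [hu] at hx'
    rw [← haF x hx', ← hf x hx']
    ring
  have i1 : IntervalIntegrable (fun x => a' x * f x + a x * b x) volume s t :=
    (hia.mul_continuousOn (by rwa [hu])).add (hb.continuousOn_mul (by rwa [hu]))
  have i2 : IntervalIntegrable (fun x => f s * a' x + a s * b x) volume s t :=
    (hia.const_mul _).add (hb.const_mul _)
  rw [e1, intervalIntegral.integral_sub i1 i2,
    intervalIntegral.integral_add (hia.const_mul _) (hb.const_mul _),
    intervalIntegral.integral_const_mul, intervalIntegral.integral_const_mul,
    ← haF t ⟨hst, le_rfl⟩, ← hf t ⟨hst, le_rfl⟩] at key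
  linarith

/-- A compact subset of `(0,1)` lies in some `[α, β]` with `0 < α`, `β < 1`. -/
theorem exists_Icc_of_isCompact {K : Set ℝ} (hK : IsCompact K) (h : K ⊆ Ioo 0 1) :
    ∃ α β : ℝ, 0 < α ∧ α ≤ β ∧ β < 1 ∧ K ⊆ Icc α β := by
  rcases K.eq_empty_or_nonempty with rfl | hne
  · exact ⟨1 / 2, 1 / 2, by norm_num, le_rfl, by norm_num, empty_subset _⟩
  · obtain ⟨x, hx, hx'⟩ := hK.exists_isLeast hne
    obtain ⟨y, hy, hy'⟩ := hK.exists_isGreatest hne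
    exact ⟨x, y, (h hx).1, hx' hy, (h hy).2, fun z hz => ⟨hx' hz, hy' hz⟩⟩

/-- A smooth function with mean zero and compact support in `(0,1)` is the derivative of such a
function. -/
theorem exists_smooth_primitive {g : ℝ → ℝ} (hg : ContDiff ℝ ∞ g) {K : Set ℝ} (hK : IsCompact K)
    (hK1 : K ⊆ Ioo 0 1) (hgK : ∀ x, x ∉ K → g x = 0) (h0 : ∫ x in (0 : ℝ)..1, g x = 0) :
    ∃ θ : ℝ → ℝ, ContDiff ℝ ∞ θ ∧ HasCompactSupport θ ∧ tsupport θ ⊆ Ioo 0 1 ∧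
      ∀ x, HasDerivAt θ (g x) x := by
  obtain ⟨α, β, hα, hαβ, hβ, hKs⟩ := exists_Icc_of_isCompact hK hK1
  have hgc : Continuous g := hg.continuous
  have hgi : ∀ u v, IntervalIntegrable g volume u v := fun u v => hgc.intervalIntegrable u v
  set θ : ℝ → ℝ := fun x => ∫ τ in (0 : ℝ)..x, g τ with hθ
  have hd : ∀ x, HasDerivAt θ (g x) x := fun x =>
    intervalIntegral.integral_hasDerivAt_right (hgi 0 x)
      (hgc.stronglyMeasurableAtFilter _ _) hgc.continuousAt
  have z1 : ∀ x, x < α → θ x = 0 := by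
    intro x hx
    refine (intervalIntegral.integral_congr (g := fun _ => 0) fun y hy => ?_).trans (by simp)
    refine hgK y fun hy' => ?_
    have h2 := (hKs hy').1
    have h3 := hy.2
    have h4 : max 0 x < α := max_lt hα hx
    exact absurd (h2.trans h3) (not_le.2 h4)
  have z2 : ∀ x, β < x → θ x = 0 := by
    intro x hx
    have : θ x = (∫ τ in (0 : ℝ)..1, g τ) + ∫ τ in (1 : ℝ)..x, g τ :=
      (intervalIntegral.integral_add_adjacent_intervals (hgi _ _) (hgi _ _)).symm
    rw [this, h0, zero_add]
    refine (intervalIntegral.integral_congr (g := fun _ => 0) fun y hy => ?_).trans (by simp)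
    refine hgK y fun hy' => ?_
    have h2 := (hKs hy').2
    have h3 := hy.1
    have h4 : β < min 1 x := lt_min hβ hx
    exact absurd (h3.trans h2) (not_le.2 h4)
  have hts : tsupport θ ⊆ Icc α β := by
    refine closure_minimal (fun x hx => ?_) isClosed_Icc
    by_contra hn
    rw [mem_Icc, not_and_or, not_le, not_le] at hn
    exact hx (hn.elim (z1 x) (z2 x))
  refine ⟨θ, ?_, HasCompactSupport.of_support_subset_isCompact isCompact_Icc
    ((subset_tsupport θ).trans hts), hts.trans (Icc_subset_Ioo hα hβ), hd⟩
  rw [contDiff_infty_iff_deriv]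
  refine ⟨fun x => (hd x).differentiableAt, ?_⟩
  have : deriv θ = g := funext fun x => (hd x).deriv
  rwa [this]

/-- A continuous function whose distributional derivative on `(0,1)` is the integrable function
`b` is a primitive of `b`. -/
theorem sub_eq_integral_of_weak_deriv {m b : ℝ → ℝ} (hm : ContinuousOn m (Icc 0 1))
    (hb : IntervalIntegrable b volume 0 1)
    (h : ∀ θ : ℝ → ℝ, ContDiff ℝ ∞ θ → HasCompactSupport θ → tsupport θ ⊆ Ioo 0 1 →
      ∫ t in (0 : ℝ)..1, (deriv θ t * m t + θ t * b t) = 0)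
    {s t : ℝ} (hs : s ∈ Icc (0 : ℝ) 1) (ht : t ∈ Icc (0 : ℝ) 1) :
    m t - m s = ∫ τ in s..t, b τ := by
  have hu : uIcc (0 : ℝ) 1 = Icc 0 1 := uIcc_of_le zero_le_one
  set M : ℝ → ℝ := fun x => ∫ τ in (0 : ℝ)..x, b τ with hM
  have hMc : ContinuousOn M (Icc 0 1) := by
    have := intervalIntegral.continuousOn_primitive_interval' hb left_mem_uIcc
    rwa [hu] at this
  set f : ℝ → ℝ := fun x => m x - M x with hf
  have hfc : ContinuousOn f (Icc 0 1) := hm.sub hMc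
  -- `m - M` has zero weak derivative; it remains to see that it is constant.
  have hweak : ∀ θ : ℝ → ℝ, ContDiff ℝ ∞ θ → HasCompactSupport θ → tsupport θ ⊆ Ioo 0 1 →
      ∫ t in (0 : ℝ)..1, deriv θ t * f t = 0 := by
    intro θ h1 h2 h3
    have hθ' : Continuous (deriv θ) := h1.continuous_deriv (by simp)
    have z : ∀ x, x ∉ Ioo (0 : ℝ) 1 → θ x = 0 := fun x hx =>
      image_eq_zero_of_notMem_tsupport fun hx' => hx (h3 hx')
    have e := mul_sub_mul_eq_integral (f := M) (a := θ) (a' := deriv θ) zero_le_one hb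
      (fun x _ => by simp [hM])
      (fun x _ => ((h1.differentiable (by simp)) x).hasDerivAt) hθ'.continuousOn
    rw [z 1 (by simp), z 0 (by simp)] at e
    have e2 := h θ h1 h2 h3
    have iA : IntervalIntegrable (fun t => deriv θ t * m t + θ t * b t) volume 0 1 :=
      ((hθ'.continuousOn.mul hm).intervalIntegrable_of_Icc zero_le_one).add
        (hb.continuousOn_mul h1.continuous.continuousOn)
    have iB : IntervalIntegrable (fun t => deriv θ t * M t + θ t * b t) volume 0 1 :=
      ((hθ'.continuousOn.mul hMc).intervalIntegrable_of_Icc zero_le_one).add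
        (hb.continuousOn_mul h1.continuous.continuousOn)
    have e3 := intervalIntegral.integral_sub iA iB
    rw [e2, ← e] at e3
    simp only [zero_mul, sub_zero] at e3
    refine Eq.trans ?_ e3
    refine intervalIntegral.integral_congr fun x _ => ?_
    simp only [hf]
    ring
  -- Du Bois-Reymond: with a fixed bump `ψ₀` of unit mass, `ψ - (∫ ψ) ψ₀` has mean zero for every
  -- test function `ψ`, so it is an admissible `deriv θ`.
  let B : ContDiffBump (1 / 2 : ℝ) := ⟨1 / 8, 1 / 4, by norm_num, by norm_num⟩
  set ψ₀ : ℝ → ℝ := B.normed volume with hψ₀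
  have hB1 : Metric.closedBall (1 / 2 : ℝ) (1 / 4) ⊆ Ioo 0 1 := by
    intro x hx
    rw [Real.closedBall_eq_Icc] at hx
    exact ⟨by linarith [hx.1], by linarith [hx.2]⟩
  have hts0 : tsupport ψ₀ ⊆ Ioo 0 1 := by
    rw [hψ₀, B.tsupport_normed_eq]
    exact hB1
  have hint : ∀ g : ℝ → ℝ, tsupport g ⊆ Ioo 0 1 → ∫ x, g x = ∫ x in (0 : ℝ)..1, g x := by
    intro g hg
    rw [intervalIntegral.integral_of_le zero_le_one,
      setIntegral_eq_integral_of_forall_compl_eq_zero]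
    intro x hx
    exact image_eq_zero_of_notMem_tsupport fun hx' => hx (Ioo_subset_Ioc_self (hg hx'))
  have hψ1 : ∫ x in (0 : ℝ)..1, ψ₀ x = 1 := by
    rw [← hint ψ₀ hts0]
    exact B.integral_normed
  set C : ℝ := ∫ x in (0 : ℝ)..1, ψ₀ x * f x with hC
  have hψ₀s : ContDiff ℝ ∞ ψ₀ := B.contDiff_normed
  have hae : ∀ᵐ x, x ∈ Ioo (0 : ℝ) 1 → f x - C = 0 := by
    refine isOpen_Ioo.ae_eq_zero_of_integral_contDiff_smul_eq_zero ?_ ?_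
    · exact (((hfc.sub continuousOn_const).mono Ioo_subset_Icc_self).locallyIntegrableOn
        measurableSet_Ioo)
    · intro ψ p1 p2 p3
      set c : ℝ := ∫ x in (0 : ℝ)..1, ψ x with hc
      have hψi : IntervalIntegrable ψ volume 0 1 := p1.continuous.intervalIntegrable _ _
      have hψ0i : IntervalIntegrable ψ₀ volume 0 1 := hψ₀s.continuous.intervalIntegrable _ _
      obtain ⟨θ, t1, t2, t3, t4⟩ := exists_smooth_primitive (g := fun x => ψ x - c * ψ₀ x)
        (p1.sub (contDiff_const.mul hψ₀s)) (p2.isCompact.union B.hasCompactSupport_normed.isCompact)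
        (union_subset p3 hts0)
        (fun x hx => by
          rw [mem_union, not_or] at hx
          rw [image_eq_zero_of_notMem_tsupport hx.1]
          have : ψ₀ x = 0 := image_eq_zero_of_notMem_tsupport hx.2
          rw [this]
          ring)
        (by
          rw [intervalIntegral.integral_sub hψi (hψ0i.const_mul c),
            intervalIntegral.integral_const_mul, hψ1]
          ring)
      have e := hweak θ t1 t2 t3
      have j1 : IntervalIntegrable (fun x => ψ x * f x) volume 0 1 :=
        (p1.continuous.continuousOn.mul hfc).intervalIntegrable_of_Icc zero_le_one
      have j2 : IntervalIntegrable (fun x => ψ₀ x * f x) volume 0 1 :=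
        (hψ₀s.continuous.continuousOn.mul hfc).intervalIntegrable_of_Icc zero_le_one
      have e' : ∫ x in (0 : ℝ)..1, (ψ x * f x - c * (ψ₀ x * f x)) = 0 := by
        refine Eq.trans ?_ e
        refine intervalIntegral.integral_congr fun x _ => ?_
        simp only [(t4 x).deriv]
        ring
      rw [intervalIntegral.integral_sub j1 (j2.const_mul c),
        intervalIntegral.integral_const_mul] at e'
      rw [hint]
      · have : ∫ x in (0 : ℝ)..1, (ψ x * f x - C * ψ x) = 0 := by
          rw [intervalIntegral.integral_sub j1 (hψi.const_mul C),
            intervalIntegral.integral_const_mul]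
          linarith
        refine Eq.trans ?_ this
        refine intervalIntegral.integral_congr fun x _ => ?_
        simp only [smul_eq_mul]
        ring
      · exact (tsupport_smul_subset_left ψ _).trans p3
  have hev : EqOn f (fun _ => C) (Icc 0 1) := by
    have h1 : f =ᵐ[volume.restrict (Icc 0 1)] fun _ => C := by
      rw [← restrict_Ioo_eq_restrict_Icc]
      rw [Filter.EventuallyEq, ae_restrict_iff' measurableSet_Ioo]
      filter_upwards [hae] with x hx hx'
      linarith [hx hx']
    exact Measure.eqOn_Icc_of_ae_eq volume (by norm_num) h1 hfc continuousOn_const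
  have e1 := hev hs
  have e2 := hev ht
  simp only [hf, hM] at e1 e2
  have hsub : ∀ u ∈ Icc (0 : ℝ) 1, IntervalIntegrable b volume 0 u := fun u hu' =>
    hb.mono_set (by rw [uIcc_of_le hu'.1, hu]; exact Icc_subset_Icc_right hu'.2)
  rw [← intervalIntegral.integral_interval_sub_left (hsub t ht) (hsub s hs)]
  linarith

/-! ### Integration over slabs -/

/-- The slab `ℝ × (s,t)`. -/
def slab (s t : ℝ) : Set (ℝ × ℝ) := univ ×ˢ Ioo s t

theorem measurableSet_slab (s t : ℝ) : MeasurableSet (slab s t) :=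
  MeasurableSet.univ.prod measurableSet_Ioo

theorem stripMeasure_restrict_slab {s t : ℝ} (hs : 0 ≤ s) (ht : t ≤ 1) :
    stripMeasure.restrict (slab s t) = (volume : Measure ℝ).prod (volume.restrict (Ioo s t)) := by
  rw [stripMeasure, slab, Measure.restrict_restrict (MeasurableSet.univ.prod measurableSet_Ioo),
    inter_eq_left.2 (prod_mono_right (Ioo_subset_Ioo hs ht)), Measure.volume_eq_prod,
    ← Measure.prod_restrict, Measure.restrict_univ]

theorem stripMeasure_eq_prod :
    stripMeasure = (volume : Measure ℝ).prod (volume.restrict (Ioo 0 1)) := by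
  rw [← stripMeasure_restrict_slab le_rfl le_rfl, slab, stripMeasure, Measure.restrict_restrict
    (MeasurableSet.univ.prod measurableSet_Ioo), inter_self]

theorem stripMeasure_restrict_slab_zero_one : stripMeasure.restrict (slab 0 1) = stripMeasure := by
  rw [stripMeasure_restrict_slab le_rfl le_rfl, stripMeasure_eq_prod]

theorem ae_slice {P : ℝ × ℝ → Prop} (h : ∀ᵐ p ∂stripMeasure, P p) :
    ∀ᵐ t ∂(volume.restrict (Ioo (0 : ℝ) 1)), ∀ᵐ x, P (x, t) := by
  rw [stripMeasure_eq_prod] at h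
  exact Measure.ae_ae_of_ae_prod
    (Measure.measurePreserving_swap.quasiMeasurePreserving.ae h)

theorem integrableOn_slab_mul {F : ℝ × ℝ → ℝ} (hF : Integrable F stripMeasure) {s t : ℝ}
    {h : ℝ → ℝ} (hh : ContinuousOn h (Icc s t)) :
    IntegrableOn (fun p => h p.2 * F p) (slab s t) stripMeasure := by
  obtain ⟨C, hC⟩ := isCompact_Icc.exists_bound_of_continuousOn hh
  refine Integrable.bdd_mul (c := C) hF.integrableOn ?_ ?_
  · exact ((hh.mono Ioo_subset_Icc_self).comp continuous_snd.continuousOn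
      fun p hp => hp.2).aestronglyMeasurable (measurableSet_slab s t)
  · filter_upwards [ae_restrict_mem (measurableSet_slab s t)] with p hp
    exact hC p.2 (Ioo_subset_Icc_self hp.2)

theorem setIntegral_slab {F : ℝ × ℝ → ℝ} (hF : Integrable F stripMeasure) {s t : ℝ} (hs : 0 ≤ s)
    (hst : s ≤ t) (ht : t ≤ 1) {h : ℝ → ℝ} (hh : ContinuousOn h (Icc s t)) :
    ∫ p in slab s t, h p.2 * F p ∂stripMeasure = ∫ τ in s..t, h τ * ∫ x, F (x, τ) := by
  have h1 := integrableOn_slab_mul hF hh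
  rw [IntegrableOn, stripMeasure_restrict_slab hs ht] at h1
  rw [stripMeasure_restrict_slab hs ht, integral_prod_symm _ h1,
    intervalIntegral.integral_of_le hst, ← integral_Ioc_eq_integral_Ioo]
  refine integral_congr_ae (ae_of_all _ fun τ => ?_)
  simp only [integral_const_mul]

theorem intervalIntegrable_slice_integral {F : ℝ × ℝ → ℝ} (hF : Integrable F stripMeasure) :
    IntervalIntegrable (fun τ => ∫ x, F (x, τ)) volume 0 1 := by
  rw [stripMeasure_eq_prod] at hF
  rw [intervalIntegrable_iff_integrableOn_Ioo_of_le zero_le_one]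
  exact hF.integral_prod_right

/-! ### Admissible pairs -/

/-- The second moment of `ρ(·,t)`. -/
def Pair.moment (d : Pair) (t : ℝ) : ℝ := ∫ x, x ^ 2 ∂(d.curve t)

/-- The rate of change `∫ 2 x β(x,t) dx` of the second moment. -/
def Pair.momentRate (d : Pair) (t : ℝ) : ℝ := ∫ x, 2 * (x * d.beta (x, t))

namespace AdmissibleEta

variable {d : Pair}

/-- The null set of times does not depend on `g`, so the same times serve for the mass, the second
moment and absolute values. -/
theorem slice (hd : AdmissibleEta d) : ∀ᵐ t ∂(volume.restrict (Ioo (0 : ℝ) 1)), ∀ g : ℝ → ℝ,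
    (Integrable g (d.curve t) ↔ Integrable (fun x => g x * d.density (x, t))) ∧
    ∫ x, g x ∂(d.curve t) = ∫ x, g x * d.density (x, t) := by
  have h1 : ∀ᵐ t ∂(volume.restrict (Ioo (0 : ℝ) 1)),
      AEStronglyMeasurable (fun x => d.density (x, t)) volume := by
    have := hd.density_memLp.1
    rw [stripMeasure_eq_prod] at this
    exact this.prodMk_right
  filter_upwards [h1, ae_slice hd.density_nonneg, hd.curve_eq] with t h1 h2 h3 g
  have hm : AEMeasurable (fun x => ENNReal.ofReal (d.density (x, t))) volume :=
    h1.aemeasurable.ennreal_ofReal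
  have hfin : ∀ᵐ x : ℝ, ENNReal.ofReal (d.density (x, t)) < ⊤ :=
    ae_of_all _ fun x => ENNReal.ofReal_lt_top
  have hcongr : (fun x => (ENNReal.ofReal (d.density (x, t))).toReal • g x)
      =ᵐ[volume] fun x => g x * d.density (x, t) := by
    filter_upwards [h2] with x hx
    rw [ENNReal.toReal_ofReal hx, smul_eq_mul, mul_comm]
  rw [h3]
  exact ⟨(integrable_withDensity_iff_integrable_smul₀' hm hfin).trans (integrable_congr hcongr),
    (integral_withDensity_eq_integral_toReal_smul₀ hm hfin g).trans (integral_congr_ae hcongr)⟩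

theorem integrable_of_growth (hd : AdmissibleEta d) {t : ℝ} (ht : t ∈ Icc (0 : ℝ) 1) {g : ℝ → ℝ}
    (hg : Continuous g) {C : ℝ} (hC : ∀ x, |g x| ≤ C * (1 + x ^ 2)) :
    Integrable g (d.curve t) := by
  have := hd.curve_cont.prob t ht
  refine (((integrable_const (1 : ℝ)).add (hd.curve_cont.moment t ht)).const_mul C).mono'
    hg.aestronglyMeasurable (ae_of_all _ fun x => ?_)
  simpa using hC x

/-- By Fubini it suffices that `∫ |g| dρ(·,t)` be integrable in time, and it is continuous on
`[0,1]` by continuity in `𝒫₂`. -/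
theorem integrable_mul_density (hd : AdmissibleEta d) {g : ℝ → ℝ}
    (hg : Continuous g) {C : ℝ} (hC : ∀ x, |g x| ≤ C * (1 + x ^ 2)) :
    Integrable (fun p => g p.1 * d.density p) stripMeasure := by
  have hm : AEStronglyMeasurable (fun p : ℝ × ℝ => g p.1 * d.density p) stripMeasure :=
    (hg.comp continuous_fst).aestronglyMeasurable.mul hd.density_memLp.1
  rw [stripMeasure_eq_prod] at hm ⊢
  rw [integrable_prod_iff' hm]
  have hmem : ∀ᵐ t ∂(volume.restrict (Ioo (0 : ℝ) 1)), t ∈ Ioo (0 : ℝ) 1 :=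
    ae_restrict_mem measurableSet_Ioo
  constructor
  · filter_upwards [hd.slice, hmem] with t h1 h2
    exact (h1 g).1.1 (hd.integrable_of_growth (Ioo_subset_Icc_self h2) hg hC)
  · have h1 : ContinuousOn (fun t => ∫ x, |g x| ∂(d.curve t)) (Icc 0 1) :=
      hd.curve_cont.cont _ hg.abs ⟨C, by simpa using hC⟩
    refine (h1.integrableOn_Icc.mono_set Ioo_subset_Icc_self).congr ?_
    filter_upwards [hd.slice, ae_slice hd.density_nonneg] with t h1 h2
    rw [(h1 _).2]
    refine integral_congr_ae ?_
    filter_upwards [h2] with x hx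
    rw [Real.norm_eq_abs, abs_mul, abs_of_nonneg hx]

theorem integrable_sq_mul_density (hd : AdmissibleEta d) :
    Integrable (fun p => p.1 ^ 2 * d.density p) stripMeasure :=
  hd.integrable_mul_density (continuous_pow 2) (C := 1) fun x => by
    rw [abs_of_nonneg (sq_nonneg x)]; linarith

theorem integrable_density (hd : AdmissibleEta d) : Integrable d.density stripMeasure := by
  simpa using hd.integrable_mul_density (g := fun _ => 1) continuous_const (C := 1) fun x => by
    rw [abs_one]; nlinarith [sq_nonneg x]

/-- `|x β|` is at most the product of `|x| √ρ` and `A`, both square integrable. -/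
theorem integrable_mul_beta (hd : AdmissibleEta d) :
    Integrable (fun p => p.1 * d.beta p) stripMeasure := by
  obtain ⟨A, hA, hb⟩ := hd.bound
  refine (hd.integrable_sq_mul_density.add hA.integrable_sq).mono'
    (measurable_fst.aestronglyMeasurable.mul hd.beta_memLp.1) ?_
  filter_upwards [hb, hd.density_nonneg] with p h1 h2
  rw [Real.norm_eq_abs, abs_mul]
  have h3 := Real.sq_sqrt h2
  have h4 : |p.1| * |d.beta p| ≤ |p.1| * (A p * √(d.density p)) := by gcongr
  have h5 := sq_abs p.1
  simp only [Pi.add_apply]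
  rw [← h5]
  calc |p.1| * |d.beta p| ≤ |p.1| * (A p * √(d.density p)) := h4
    _ ≤ |p.1| ^ 2 * √(d.density p) ^ 2 + A p ^ 2 := by
      nlinarith [sq_nonneg (|p.1| * √(d.density p) - A p), sq_nonneg (|p.1| * √(d.density p)),
        sq_nonneg (A p)]
    _ = |p.1| ^ 2 * d.density p + A p ^ 2 := by rw [h3]

theorem continuousOn_moment (hd : AdmissibleEta d) : ContinuousOn d.moment (Icc 0 1) :=
  hd.curve_cont.cont _ (continuous_pow 2) ⟨1, fun x => by
    rw [abs_of_nonneg (sq_nonneg x)]; linarith⟩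

theorem intervalIntegrable_momentRate (hd : AdmissibleEta d) :
    IntervalIntegrable d.momentRate volume 0 1 :=
  intervalIntegrable_slice_integral (hd.integrable_mul_beta.const_mul 2)

theorem slice_moment (hd : AdmissibleEta d) : ∀ᵐ t ∂(volume.restrict (Ioo (0 : ℝ) 1)),
    ∫ x, x ^ 2 * d.density (x, t) = d.moment t := by
  filter_upwards [hd.slice] with t ht
  exact ((ht _).2).symm

theorem slice_mass (hd : AdmissibleEta d) : ∀ᵐ t ∂(volume.restrict (Ioo (0 : ℝ) 1)),
    ∫ x, d.density (x, t) = 1 := by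
  filter_upwards [hd.slice, ae_restrict_mem measurableSet_Ioo] with t ht hmem
  have := hd.curve_cont.prob t (Ioo_subset_Icc_self hmem)
  have h := (ht fun _ => 1).2
  simpa using h.symm

end AdmissibleEta

theorem integral_congr_of_ae_strip {s t : ℝ} (hs : 0 ≤ s) (hst : s ≤ t) (ht : t ≤ 1)
    {f g : ℝ → ℝ} (h : ∀ᵐ τ ∂(volume.restrict (Ioo (0 : ℝ) 1)), f τ = g τ) :
    ∫ τ in s..t, f τ = ∫ τ in s..t, g τ := by
  rw [intervalIntegral.integral_of_le hst, intervalIntegral.integral_of_le hst,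
    integral_Ioc_eq_integral_Ioo, integral_Ioc_eq_integral_Ioo]
  exact integral_congr_ae (ae_restrict_of_ae_restrict_of_subset (Ioo_subset_Ioo hs ht) h)

/-! ### The evolution of the second moment -/

/-- A compactly supported smooth function that agrees with `x²` near the origin. -/
theorem exists_cutoff_sq : ∃ (q : ℝ → ℝ) (C : ℝ), ContDiff ℝ ∞ q ∧ HasCompactSupport q ∧
    (∀ x, |x| < 1 → q x = x ^ 2) ∧ (∀ x, |q x| ≤ x ^ 2) ∧ ∀ x, |deriv q x| ≤ C * |x| := by
  let B : ContDiffBump (0 : ℝ) := ⟨1, 2, by norm_num, by norm_num⟩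
  have hB : ContDiff ℝ ∞ B := B.contDiff
  have hBd : Differentiable ℝ B := hB.differentiable (by simp)
  obtain ⟨K, hK⟩ := B.hasCompactSupport.deriv.exists_bound_of_continuous
    (hB.continuous_deriv (by simp))
  have hder : ∀ x, HasDerivAt (fun x => x ^ 2 * B x) (2 * x * B x + x ^ 2 * deriv B x) x :=
    fun x => by
      have h1 : HasDerivAt (fun x : ℝ => x ^ 2) (2 * x) x := by simpa using hasDerivAt_pow 2 x
      exact h1.mul (hBd x).hasDerivAt
  have hK0 : 0 ≤ K := (norm_nonneg _).trans (hK 0)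
  refine ⟨fun x => x ^ 2 * B x, 2 + 2 * K, (contDiff_id.pow 2).mul hB,
    B.hasCompactSupport.mul_left, fun x hx => ?_, fun x => ?_, fun x => ?_⟩
  · have : B x = 1 := B.one_of_mem_closedBall (by
      rw [Metric.mem_closedBall, dist_zero_right]
      exact hx.le)
    simp only [this, mul_one]
  · simp only
    rw [abs_mul, abs_of_nonneg (sq_nonneg x), abs_of_nonneg B.nonneg]
    exact mul_le_of_le_one_right (sq_nonneg x) B.le_one
  · rw [(hder x).deriv]
    have h1 : |2 * x * B x| ≤ 2 * |x| := by
      rw [abs_mul, abs_mul, abs_of_nonneg B.nonneg, abs_two]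
      exact mul_le_of_le_one_right (by positivity) B.le_one
    have h2 : |x ^ 2 * deriv B x| ≤ 2 * K * |x| := by
      by_cases hx : x ∈ tsupport B
      · rw [B.tsupport_eq, Metric.mem_closedBall, dist_zero_right, Real.norm_eq_abs] at hx
        rw [abs_mul, abs_of_nonneg (sq_nonneg x), ← sq_abs x]
        have := hK x
        rw [Real.norm_eq_abs] at this
        have hx2 : |x| ≤ 2 := hx
        calc |x| ^ 2 * |deriv B x| ≤ |x| ^ 2 * K := by gcongr
          _ = |x| * (|x| * K) := by ring
          _ ≤ 2 * (|x| * K) := by gcongr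
          _ = 2 * K * |x| := by ring
      · have : deriv B x = 0 := image_eq_zero_of_notMem_tsupport fun h =>
          hx (tsupport_deriv_subset h)
        rw [this, mul_zero, abs_zero]
        positivity
    calc |2 * x * B x + x ^ 2 * deriv B x| ≤ |2 * x * B x| + |x ^ 2 * deriv B x| := abs_add_le _ _
      _ ≤ 2 * |x| + 2 * K * |x| := add_le_add h1 h2
      _ = (2 + 2 * K) * |x| := by ring

namespace AdmissibleEta

variable {d : Pair}

theorem integral_separated_test (hd : AdmissibleEta d) {q θ : ℝ → ℝ} (hq : ContDiff ℝ ∞ q)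
    (hqc : HasCompactSupport q) (hθ : ContDiff ℝ ∞ θ) (hθc : HasCompactSupport θ)
    (hθs : tsupport θ ⊆ Ioo 0 1) :
    ∫ p, (d.density p * (q p.1 * deriv θ p.2) + d.beta p * (deriv q p.1 * θ p.2))
      ∂stripMeasure = 0 := by
  have hsupp : tsupport (fun p : ℝ × ℝ => q p.1 * θ p.2) ⊆ tsupport q ×ˢ tsupport θ := by
    refine closure_minimal (fun p hp => ?_) ((isClosed_tsupport q).prod (isClosed_tsupport θ))
    exact ⟨subset_tsupport q (left_ne_zero_of_mul hp), subset_tsupport θ (right_ne_zero_of_mul hp)⟩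
  have h := hd.continuityEq (fun p => q p.1 * θ p.2)
    ((hq.comp contDiff_fst).mul (hθ.comp contDiff_snd))
    (HasCompactSupport.of_support_subset_isCompact (hqc.isCompact.prod hθc.isCompact)
      ((subset_tsupport _).trans hsupp))
    (hsupp.trans (prod_mono (subset_univ _) hθs))
  rw [← h]
  refine integral_congr_ae (ae_of_all _ fun p => ?_)
  have h1 : HasFDerivAt (fun p : ℝ × ℝ => q p.1)
      ((ContinuousLinearMap.toSpanSingleton ℝ (deriv q p.1)).comp (ContinuousLinearMap.fst ℝ ℝ ℝ)) p :=
    ((hq.differentiable (by simp)) p.1).hasDerivAt.hasFDerivAt.comp p hasFDerivAt_fst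
  have h2 : HasFDerivAt (fun p : ℝ × ℝ => θ p.2)
      ((ContinuousLinearMap.toSpanSingleton ℝ (deriv θ p.2)).comp (ContinuousLinearMap.snd ℝ ℝ ℝ)) p :=
    ((hθ.differentiable (by simp)) p.2).hasDerivAt.hasFDerivAt.comp p hasFDerivAt_snd
  simp only
  rw [(h1.fun_mul h2).fderiv]
  simp only [add_apply, smul_apply,
    ContinuousLinearMap.comp_apply, ContinuousLinearMap.coe_fst', ContinuousLinearMap.coe_snd',
    ContinuousLinearMap.toSpanSingleton_apply, smul_eq_mul]
  ring

/-- The test function `x² θ(t)` lacks compact support. It is approximated by `Q n x = (n+1)²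
q(x/(n+1))`, equal to `x²` for `|x| < n+1`. This scaling keeps `|Q n| ≤ x²` and `|(Q n)'| ≤ C |x|`
uniform in `n`, so dominated convergence applies. -/
theorem integral_sq_test (hd : AdmissibleEta d) {θ : ℝ → ℝ} (hθ : ContDiff ℝ ∞ θ)
    (hθc : HasCompactSupport θ) (hθs : tsupport θ ⊆ Ioo 0 1) :
    ∫ p, (deriv θ p.2 * (p.1 ^ 2 * d.density p) + θ p.2 * (2 * (p.1 * d.beta p)))
      ∂stripMeasure = 0 := by
  obtain ⟨q, C, q1, q2, q3, q4, q5⟩ := exists_cutoff_sq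
  have hqd : Differentiable ℝ q := q1.differentiable (by simp)
  have hθ' : Continuous (deriv θ) := hθ.continuous_deriv (by simp)
  obtain ⟨K, hK⟩ := hθc.exists_bound_of_continuous hθ.continuous
  obtain ⟨K', hK'⟩ := hθc.deriv.exists_bound_of_continuous hθ'
  have hC : 0 ≤ C := by simpa using (abs_nonneg _).trans (q5 1)
  have hK0 : 0 ≤ K := (norm_nonneg _).trans (hK 0)
  have hK0' : 0 ≤ K' := (norm_nonneg _).trans (hK' 0)
  have hR : ∀ n : ℕ, (0 : ℝ) < n + 1 := fun n => by positivity
  set Q : ℕ → ℝ → ℝ := fun n x => ((n : ℝ) + 1) ^ 2 * q (x / (n + 1)) with hQ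
  have hQd : ∀ n x, deriv (Q n) x = (n + 1) * deriv q (x / (n + 1)) := by
    intro n x
    have h1 : HasDerivAt (fun x : ℝ => x / (n + 1)) (1 / (n + 1)) x :=
      (hasDerivAt_id x).div_const _
    have h2 := ((hqd (x / (n + 1))).hasDerivAt.comp x h1).const_mul (((n : ℝ) + 1) ^ 2)
    refine h2.deriv.trans ?_
    have := (hR n).ne'
    field_simp
  have hQs : ∀ n, ContDiff ℝ ∞ (Q n) := fun n =>
    contDiff_const.mul (q1.comp (contDiff_id.div_const _))
  have hQc : ∀ n, HasCompactSupport (Q n) := fun n => by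
    refine HasCompactSupport.mul_left ?_
    refine q2.comp_homeomorph (Homeomorph.mulRight₀ ((n : ℝ) + 1)⁻¹ (inv_ne_zero (hR n).ne'))
  have hzero : ∀ n, ∫ p, (d.density p * (Q n p.1 * deriv θ p.2)
      + d.beta p * (deriv (Q n) p.1 * θ p.2)) ∂stripMeasure = 0 := fun n =>
    hd.integral_separated_test (hQs n) (hQc n) hθ hθc hθs
  have hmeas : ∀ n, AEStronglyMeasurable (fun p : ℝ × ℝ => d.density p * (Q n p.1 * deriv θ p.2)
      + d.beta p * (deriv (Q n) p.1 * θ p.2)) stripMeasure := fun n => by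
    have c1 : Continuous fun p : ℝ × ℝ => Q n p.1 * deriv θ p.2 :=
      ((hQs n).continuous.comp continuous_fst).mul (hθ'.comp continuous_snd)
    have c2 : Continuous fun p : ℝ × ℝ => deriv (Q n) p.1 * θ p.2 :=
      (((hQs n).continuous_deriv (by simp)).comp continuous_fst).mul
        (hθ.continuous.comp continuous_snd)
    exact (hd.density_memLp.1.mul c1.aestronglyMeasurable).add
      (hd.beta_memLp.1.mul c2.aestronglyMeasurable)
  have hlim := tendsto_integral_of_dominated_convergence
    (F := fun (n : ℕ) (p : ℝ × ℝ) => d.density p * (Q n p.1 * deriv θ p.2)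
      + d.beta p * (deriv (Q n) p.1 * θ p.2))
    (f := fun p => deriv θ p.2 * (p.1 ^ 2 * d.density p) + θ p.2 * (2 * (p.1 * d.beta p)))
    (fun p => K' * |p.1 ^ 2 * d.density p| + C * K * |p.1 * d.beta p|) hmeas
    ((hd.integrable_sq_mul_density.abs.const_mul _).add (hd.integrable_mul_beta.abs.const_mul _))
    (fun n => ae_of_all _ fun p => ?_) (ae_of_all _ fun p => ?_)
  · simp only [hzero] at hlim
    exact tendsto_nhds_unique hlim tendsto_const_nhds
  · have e1 : |Q n p.1| ≤ p.1 ^ 2 := by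
      have := q4 (p.1 / (n + 1))
      rw [hQ]
      simp only
      rw [abs_mul, abs_of_nonneg (sq_nonneg _)]
      calc ((n : ℝ) + 1) ^ 2 * |q (p.1 / (n + 1))| ≤ (n + 1) ^ 2 * (p.1 / (n + 1)) ^ 2 := by gcongr
        _ = p.1 ^ 2 := by have := (hR n).ne'; field_simp
    have e2 : |deriv (Q n) p.1| ≤ C * |p.1| := by
      rw [hQd, abs_mul, abs_of_pos (hR n)]
      calc ((n : ℝ) + 1) * |deriv q (p.1 / (n + 1))| ≤ (n + 1) * (C * |p.1 / (n + 1)|) := by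
            gcongr
            exact q5 _
        _ = C * |p.1| := by
          rw [abs_div, abs_of_pos (hR n)]
          have := (hR n).ne'
          field_simp
    have e3 := hK p.2
    have e4 := hK' p.2
    rw [Real.norm_eq_abs] at e3 e4 ⊢
    calc |d.density p * (Q n p.1 * deriv θ p.2) + d.beta p * (deriv (Q n) p.1 * θ p.2)|
        ≤ |d.density p| * (|Q n p.1| * |deriv θ p.2|) + |d.beta p| * (|deriv (Q n) p.1| * |θ p.2|) := by
          rw [← abs_mul, ← abs_mul, ← abs_mul, ← abs_mul]
          exact abs_add_le _ _
      _ ≤ |d.density p| * (p.1 ^ 2 * K') + |d.beta p| * ((C * |p.1|) * K) := by gcongr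
      _ = K' * |p.1 ^ 2 * d.density p| + C * K * |p.1 * d.beta p| := by
          rw [abs_mul, abs_mul, abs_of_nonneg (sq_nonneg p.1)]
          ring
  -- At a fixed point the integrand no longer depends on `n` once `n + 1 > |x|`.
  · refine tendsto_const_nhds.congr' ?_
    obtain ⟨N, hN⟩ := exists_nat_gt |p.1|
    filter_upwards [eventually_ge_atTop N] with n hn
    have hn' : |p.1| < n + 1 := by
      have : (N : ℝ) ≤ n := by exact_mod_cast hn
      linarith
    have hlt : |p.1 / (n + 1)| < 1 := by
      rw [abs_div, abs_of_pos (hR n), div_lt_one (hR n)]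
      exact hn'
    have hder : deriv q (p.1 / (n + 1)) = 2 * (p.1 / (n + 1)) := by
      have : q =ᶠ[𝓝 (p.1 / (n + 1))] fun y => y ^ 2 := by
        filter_upwards [(isOpen_lt continuous_abs continuous_const).mem_nhds hlt] with y hy
        exact q3 y hy
      rw [this.deriv_eq]
      simp
    rw [hQd, hder, hQ]
    simp only
    rw [q3 _ hlt]
    have := (hR n).ne'
    field_simp

theorem moment_sub (hd : AdmissibleEta d) {s t : ℝ} (hs : s ∈ Icc (0 : ℝ) 1)
    (ht : t ∈ Icc (0 : ℝ) 1) :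
    d.moment t - d.moment s = ∫ τ in s..t, d.momentRate τ := by
  refine sub_eq_integral_of_weak_deriv hd.continuousOn_moment hd.intervalIntegrable_momentRate
    (fun θ h1 h2 h3 => ?_) hs ht
  have hθ' : Continuous (deriv θ) := h1.continuous_deriv (by simp)
  have hF1 := hd.integrable_sq_mul_density
  have hF2 : Integrable (fun p => 2 * (p.1 * d.beta p)) stripMeasure :=
    hd.integrable_mul_beta.const_mul 2
  have e := hd.integral_sq_test h1 h2 h3
  rw [← stripMeasure_restrict_slab_zero_one, integral_add
    (integrableOn_slab_mul hF1 hθ'.continuousOn) (integrableOn_slab_mul hF2 h1.continuous.continuousOn),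
    setIntegral_slab hF1 le_rfl zero_le_one le_rfl hθ'.continuousOn,
    setIntegral_slab hF2 le_rfl zero_le_one le_rfl h1.continuous.continuousOn] at e
  have hi : IntervalIntegrable (fun τ => deriv θ τ * d.moment τ) volume 0 1 :=
    (hθ'.continuousOn.mul hd.continuousOn_moment).intervalIntegrable_of_Icc zero_le_one
  rw [intervalIntegral.integral_add hi
    (hd.intervalIntegrable_momentRate.continuousOn_mul h1.continuous.continuousOn)]
  refine Eq.trans ?_ e
  congr 1
  refine integral_congr_of_ae_strip le_rfl zero_le_one le_rfl ?_
  filter_upwards [hd.slice_moment] with τ hτ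
  rw [hτ]

theorem mul_moment_sub (hd : AdmissibleEta d) {s t : ℝ} (hs : 0 ≤ s) (hst : s ≤ t) (ht : t ≤ 1)
    {a a' : ℝ → ℝ} (ha : ∀ x ∈ Icc s t, HasDerivAt a (a' x) x) (ha' : ContinuousOn a' (Icc s t)) :
    a t * d.moment t - a s * d.moment s
      = ∫ τ in s..t, (a' τ * d.moment τ + a τ * d.momentRate τ) :=
  mul_sub_mul_eq_integral hst
    (hd.intervalIntegrable_momentRate.mono_set (by
      rw [uIcc_of_le hst, uIcc_of_le zero_le_one]; exact Icc_subset_Icc hs ht))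
    (fun _ hx => hd.moment_sub ⟨hs, hst.trans ht⟩ ⟨hs.trans hx.1, hx.2.trans ht⟩) ha ha'

end AdmissibleEta

/-! ### Smallness of the second moment near a Dirac mass. -/

namespace AdmissibleEta

variable {d : Pair}

theorem moment_nonneg (d : Pair) (t : ℝ) : 0 ≤ d.moment t :=
  integral_nonneg fun _ => sq_nonneg _

theorem moment_eq_zero_of_dirac {t : ℝ} (h : d.curve t = Measure.dirac 0) : d.moment t = 0 := by
  rw [Pair.moment, h, integral_dirac]
  norm_num

/-- Near a time at which `ρ` is a Dirac mass at the origin, the second moment is smaller than the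
elapsed time. -/
theorem exists_moment_le (hd : AdmissibleEta d) : ∃ e : ℝ → ℝ, IntervalIntegrable e volume 0 1 ∧
    ∀ s t z : ℝ, 0 ≤ s → s < t → t ≤ 1 → z ∈ Icc s t → d.moment z = 0 →
      ∀ τ ∈ Icc s t, d.moment τ ≤ 4 * (t - s) * ∫ σ in s..t, e σ := by
  obtain ⟨A, hA, hb⟩ := hd.bound
  have hA2 := hA.integrable_sq
  have he := intervalIntegrable_slice_integral hA2
  refine ⟨fun τ => ∫ x, A (x, τ) ^ 2, he, ?_⟩
  intro s t z hs hst ht hz hz0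
  set δ := t - s with hδ
  have hδ0 : 0 < δ := sub_pos.2 hst
  -- Young's inequality with a weight adapted to the length `δ`: integrated over `(s,t)`, the moment
  -- term is at most half of the maximum `d.moment w` and is absorbed. This leaves the factor `4 δ`.
  have hle : ∀ᵐ τ ∂(volume.restrict (Ioo (0 : ℝ) 1)),
      |d.momentRate τ| ≤ 1 / (2 * δ) * d.moment τ + 2 * δ * ∫ x, A (x, τ) ^ 2 := by
    have i1 := hd.integrable_sq_mul_density
    rw [stripMeasure_eq_prod] at i1 hA2
    filter_upwards [hd.slice_moment, i1.prod_left_ae, hA2.prod_left_ae, ae_slice hb,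
      ae_slice hd.density_nonneg] with τ h1 h2 h3 h4 h5
    rw [← h1, ← integral_const_mul, ← integral_const_mul,
      ← integral_add (h2.const_mul _) (h3.const_mul _), ← Real.norm_eq_abs]
    refine norm_integral_le_of_norm_le ((h2.const_mul _).add (h3.const_mul _)) ?_
    filter_upwards [h4, h5] with x h6 h7
    rw [Real.norm_eq_abs, abs_mul, abs_mul, abs_two]
    have h8 := Real.sq_sqrt h7
    have h9 := sq_abs x
    set y := |x| * √(d.density (x, τ)) with hy
    have hy2 : x ^ 2 * d.density (x, τ) = y ^ 2 := by rw [hy, mul_pow, h8, h9]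
    have h10 : |x| * |d.beta (x, τ)| ≤ y * A (x, τ) := by
      calc |x| * |d.beta (x, τ)| ≤ |x| * (A (x, τ) * √(d.density (x, τ))) := by gcongr
        _ = y * A (x, τ) := by rw [hy]; ring
    rw [hy2]
    have h11 : 1 / (2 * δ) * y ^ 2 + 2 * δ * A (x, τ) ^ 2 - 2 * (y * A (x, τ))
        = 1 / (2 * δ) * (y - 2 * δ * A (x, τ)) ^ 2 := by
      field_simp
      ring
    have h12 : 0 ≤ 1 / (2 * δ) * (y - 2 * δ * A (x, τ)) ^ 2 := by positivity
    linarith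
  have hsub : Icc s t ⊆ Icc 0 1 := Icc_subset_Icc hs ht
  have husub : uIcc s t ⊆ uIcc 0 1 := by rwa [uIcc_of_le hst.le, uIcc_of_le zero_le_one]
  have hbi := hd.intervalIntegrable_momentRate.mono_set husub
  have hei := he.mono_set husub
  have hmc := hd.continuousOn_moment.mono hsub
  have hmi : IntervalIntegrable d.moment volume s t := hmc.intervalIntegrable_of_Icc hst.le
  obtain ⟨w, hw, hwmax⟩ := isCompact_Icc.exists_isMaxOn (nonempty_Icc.2 hst.le) hmc
  have k1 : d.moment w ≤ ∫ τ in s..t, |d.momentRate τ| := by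
    have := hd.moment_sub (hsub hz) (hsub hw)
    rw [hz0, sub_zero] at this
    rw [this]
    refine (le_abs_self _).trans ?_
    rw [← Real.norm_eq_abs]
    refine intervalIntegral.norm_integral_le_integral_norm_uIoc.trans ?_
    rw [intervalIntegral.integral_of_le hst.le]
    refine setIntegral_mono_set ?_ (ae_of_all _ fun _ => norm_nonneg _) ?_
    · exact ((intervalIntegrable_iff_integrableOn_Ioc_of_le hst.le).1 hbi).norm
    · refine (Ioc_subset_Ioc ?_ ?_).eventuallyLE
      · exact le_min hz.1 hw.1
      · exact max_le hz.2 hw.2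
  have k2 : ∫ τ in s..t, |d.momentRate τ|
      ≤ ∫ τ in s..t, (1 / (2 * δ) * d.moment w + 2 * δ * ∫ x, A (x, τ) ^ 2) := by
    refine intervalIntegral.integral_mono_ae_restrict hst.le hbi.abs
      (intervalIntegrable_const.add (hei.const_mul _)) ?_
    rw [← restrict_Ioo_eq_restrict_Icc]
    filter_upwards [ae_restrict_of_ae_restrict_of_subset (Ioo_subset_Ioo hs ht) hle,
      ae_restrict_mem measurableSet_Ioo] with τ h1 h2
    have h3 : d.moment τ ≤ d.moment w := hwmax (Ioo_subset_Icc_self h2)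
    have h4 : 1 / (2 * δ) * d.moment τ ≤ 1 / (2 * δ) * d.moment w := by gcongr
    linarith
  rw [intervalIntegral.integral_add intervalIntegrable_const (hei.const_mul _),
    intervalIntegral.integral_const, intervalIntegral.integral_const_mul, smul_eq_mul, ← hδ] at k2
  have k3 : δ * (1 / (2 * δ) * d.moment w) = d.moment w / 2 := by field_simp
  intro τ hτ
  have k4 : d.moment τ ≤ d.moment w := hwmax hτ
  linarith

/-- The moment is at most `4 t ∫₀ᵗ e`, and the integral tends to `0`, which beats a singularity
`1/t`. -/
theorem tendsto_mul_moment_zero (hd : AdmissibleEta d) (h0 : d.curve 0 = Measure.dirac 0)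
    {a : ℝ → ℝ} {C : ℝ} (hC : 0 ≤ C) (ha : ∀ t ∈ Ioo (0 : ℝ) (1 / 2), |a t| ≤ 1 / t + C) :
    Tendsto (fun t => a t * d.moment t) (𝓝[>] 0) (𝓝 0) := by
  obtain ⟨e, he, hm⟩ := hd.exists_moment_le
  have hc : ContinuousOn (fun t => ∫ σ in (0 : ℝ)..t, e σ) (Icc 0 1) := by
    have := intervalIntegral.continuousOn_primitive_interval' he left_mem_uIcc
    rwa [uIcc_of_le zero_le_one] at this
  have hlim : Tendsto (fun t => 4 * (1 + C) * ∫ σ in (0 : ℝ)..t, e σ) (𝓝[>] 0) (𝓝 0) := by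
    have h1 := (hc 0 ⟨le_rfl, zero_le_one⟩).tendsto
    rw [intervalIntegral.integral_same] at h1
    have h2 := h1.mono_left (show 𝓝[>] (0 : ℝ) ≤ 𝓝[Icc 0 1] 0 from
        nhdsWithin_le_of_mem (Icc_mem_nhdsGT zero_lt_one))
    simpa using h2.const_mul (4 * (1 + C))
  refine squeeze_zero_norm' ?_ hlim
  filter_upwards [Ioo_mem_nhdsGT (by norm_num : (0 : ℝ) < 1 / 2)] with t ht'
  have ht : t ∈ Ioo (0 : ℝ) 1 := ⟨ht'.1, by linarith [ht'.2]⟩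
  have h1 := hm 0 t 0 le_rfl ht.1 ht.2.le ⟨le_rfl, ht.1.le⟩ (moment_eq_zero_of_dirac h0) t
    ⟨ht.1.le, le_rfl⟩
  rw [sub_zero] at h1
  have h0m := moment_nonneg d t
  -- `e` is only known to be integrable; the sign follows from `0 ≤ moment ≤ 4 t ∫ e`.
  have hI : 0 ≤ ∫ σ in (0 : ℝ)..t, e σ := by
    by_contra hneg
    have := mul_neg_of_pos_of_neg (mul_pos (by norm_num : (0 : ℝ) < 4) ht.1) (not_le.1 hneg)
    linarith
  rw [Real.norm_eq_abs, abs_mul, abs_of_nonneg h0m]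
  have ht0 := ht.1.ne'
  calc |a t| * d.moment t ≤ (1 / t + C) * (4 * t * ∫ σ in (0 : ℝ)..t, e σ) :=
        mul_le_mul (ha t ht') h1 h0m (add_nonneg (one_div_nonneg.2 ht.1.le) hC)
    _ = 4 * (1 + t * C) * ∫ σ in (0 : ℝ)..t, e σ := by field_simp
    _ ≤ 4 * (1 + C) * ∫ σ in (0 : ℝ)..t, e σ := by
      gcongr
      exact mul_le_of_le_one_left hC ht.2.le

theorem tendsto_mul_moment_one (hd : AdmissibleEta d)
    {a : ℝ → ℝ} {C : ℝ} (hC : 0 ≤ C) (ha : ∀ t ∈ Ioo (1 / 2 : ℝ) 1, |a t| ≤ 1 / (1 - t) + C) :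
    Tendsto (fun t => a t * d.moment t) (𝓝[<] 1) (𝓝 0) := by
  obtain ⟨e, he, hm⟩ := hd.exists_moment_le
  have hc : ContinuousOn (fun t => ∫ σ in t..1, e σ) (Icc 0 1) := by
    have := intervalIntegral.continuousOn_primitive_interval' he.symm left_mem_uIcc
    rw [uIcc_of_ge zero_le_one] at this
    exact this.neg.congr fun t _ => intervalIntegral.integral_symm _ _
  have hlim : Tendsto (fun t => 4 * (1 + C) * ∫ σ in t..1, e σ) (𝓝[<] 1) (𝓝 0) := by
    have h1 := (hc 1 ⟨zero_le_one, le_rfl⟩).tendsto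
    rw [intervalIntegral.integral_same] at h1
    have h2 := h1.mono_left (show 𝓝[<] (1 : ℝ) ≤ 𝓝[Icc 0 1] 1 from
        nhdsWithin_le_of_mem (Icc_mem_nhdsLT zero_lt_one))
    simpa using h2.const_mul (4 * (1 + C))
  refine squeeze_zero_norm' ?_ hlim
  filter_upwards [Ioo_mem_nhdsLT (by norm_num : (1 / 2 : ℝ) < 1)] with t ht'
  have ht : t ∈ Ioo (0 : ℝ) 1 := ⟨by linarith [ht'.1], ht'.2⟩
  have h1 := hm t 1 1 ht.1.le ht.2 le_rfl ⟨ht.2.le, le_rfl⟩ (moment_eq_zero_of_dirac hd.terminal) t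
    ⟨le_rfl, ht.2.le⟩
  have h0m := moment_nonneg d t
  have ht1 : 0 < 1 - t := sub_pos.2 ht.2
  have hI : 0 ≤ ∫ σ in t..1, e σ := by
    by_contra hneg
    have := mul_neg_of_pos_of_neg (mul_pos (by norm_num : (0 : ℝ) < 4) ht1) (not_le.1 hneg)
    linarith
  rw [Real.norm_eq_abs, abs_mul, abs_of_nonneg h0m]
  calc |a t| * d.moment t ≤ (1 / (1 - t) + C) * (4 * (1 - t) * ∫ σ in t..1, e σ) :=
        mul_le_mul (ha t ht') h1 h0m (add_nonneg (one_div_nonneg.2 ht1.le) hC)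
    _ = 4 * (1 + (1 - t) * C) * ∫ σ in t..1, e σ := by field_simp
    _ ≤ 4 * (1 + C) * ∫ σ in t..1, e σ := by
      gcongr
      exact mul_le_of_le_one_left hC (by linarith [ht.1])

end AdmissibleEta

/-! ### Profiles -/

namespace IsProfile

variable {r a k : ℝ → ℝ}

theorem halfWidth_pos (hp : IsProfile r a k) {t : ℝ} (ht : t ∈ Ioo (0 : ℝ) 1) :
    0 < halfWidth r t := by
  have := hp.pos t ht
  unfold halfWidth
  positivity

theorem mul_halfWidth (hp : IsProfile r a k) {t : ℝ} (ht : t ∈ Ioo (0 : ℝ) 1) :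
    r t * halfWidth r t = 3 / 4 := by
  have := (hp.pos t ht).ne'
  unfold halfWidth
  field_simp

theorem hasDerivAt_halfWidth (hp : IsProfile r a k) {t : ℝ} (ht : t ∈ Ioo (0 : ℝ) 1) :
    HasDerivAt (halfWidth r) (a t * halfWidth r t) t := by
  have h0 := (hp.pos t ht).ne'
  have h1 := ((hp.deriv_r t ht).const_mul 4).inv (mul_ne_zero four_ne_zero h0)
  have h2 := h1.const_mul 3
  refine (h2.congr_deriv ?_).congr_of_eventuallyEq (Eventually.of_forall fun s => ?_)
  · unfold halfWidth
    field_simp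
  · simp only [halfWidth, div_eq_mul_inv, Pi.inv_apply]

/-- `l'' = -(3/2) / l² = -(8/3) r²`. -/
theorem hasDerivAt_speed (hp : IsProfile r a k) {t : ℝ} (ht : t ∈ Ioo (0 : ℝ) 1) :
    HasDerivAt (fun t => a t * halfWidth r t) (-(8 / 3 * r t ^ 2)) t := by
  have h0 := (hp.pos t ht).ne'
  refine ((hp.deriv_a t ht).mul (hp.hasDerivAt_halfWidth ht)).congr_deriv ?_
  unfold halfWidth
  field_simp
  ring

/-- Conservation of energy for `l'' = -(3/2)/l²`: here `a l = l'` and `4 r = 3/l`. -/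
theorem exists_energy (hp : IsProfile r a k) : ∃ c, ∀ t ∈ Ioo (0 : ℝ) 1,
    (a t * halfWidth r t) ^ 2 = 4 * r t + c := by
  have hd : ∀ t ∈ Ioo (0 : ℝ) 1,
      HasDerivAt (fun t => (a t * halfWidth r t) ^ 2 - 4 * r t) 0 t := by
    intro t ht
    refine (((hp.hasDerivAt_speed ht).pow 2).sub ((hp.deriv_r t ht).const_mul 4)).congr_deriv ?_
    simp only [Nat.cast_ofNat, Nat.add_one_sub_one, pow_one]
    linear_combination -(16 / 3) * a t * r t * hp.mul_halfWidth ht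
  obtain ⟨c, hc⟩ := isOpen_Ioo.exists_is_const_of_deriv_eq_zero isPreconnected_Ioo
    (fun t ht => (hd t ht).differentiableAt.differentiableWithinAt) fun t ht => (hd t ht).deriv
  refine ⟨c, fun t ht => ?_⟩
  have := hc t ht
  linarith

/-- `(l l')' = l'² + l l'' = (4 r + c) - 2 r = 2 k' + c`. -/
theorem exists_k_eq (hp : IsProfile r a k) {c : ℝ}
    (hc : ∀ t ∈ Ioo (0 : ℝ) 1, (a t * halfWidth r t) ^ 2 = 4 * r t + c) : ∃ C, ∀ t ∈ Ioo (0 : ℝ) 1,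
    k t = (a t * halfWidth r t * halfWidth r t - c * t) / 2 + C := by
  have hd : ∀ t ∈ Ioo (0 : ℝ) 1,
      HasDerivAt (fun t => k t - (a t * halfWidth r t * halfWidth r t - c * t) / 2) 0 t := by
    intro t ht
    have h1 := hp.mul_halfWidth ht
    refine ((hp.deriv_k t ht).sub ((((hp.hasDerivAt_speed ht).mul
      (hp.hasDerivAt_halfWidth ht)).sub ((hasDerivAt_id t).const_mul c)).div_const 2)).congr_deriv ?_
    have h2 := hc t ht
    linear_combination -1 / 2 * h2 + 4 / 3 * r t * h1
  obtain ⟨C, hC⟩ := isOpen_Ioo.exists_is_const_of_deriv_eq_zero isPreconnected_Ioo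
    (fun t ht => (hd t ht).differentiableAt.differentiableWithinAt) fun t ht => (hd t ht).deriv
  refine ⟨C, fun t ht => ?_⟩
  have := hC t ht
  linarith

theorem tendsto_halfWidth {F : Filter ℝ} (hF : Tendsto r F atTop) :
    Tendsto (halfWidth r) F (𝓝 0) :=
  (hF.const_mul_atTop (by norm_num : (0 : ℝ) < 4)).const_div_atTop 3

/-- `k` stays bounded although `r → ∞`: by the energy identity `(l l')² = 3 l + c l²`, which tends
to `0`. -/
theorem exists_tendsto_k (hp : IsProfile r a k) : ∃ k₁, Tendsto k (𝓝[<] 1) (𝓝 k₁) := by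
  obtain ⟨c, hc⟩ := hp.exists_energy
  obtain ⟨C, hC⟩ := hp.exists_k_eq hc
  have hl := tendsto_halfWidth hp.r_one
  have hmem : ∀ᶠ t in 𝓝[<] (1 : ℝ), t ∈ Ioo (0 : ℝ) 1 := Ioo_mem_nhdsLT zero_lt_one
  have h1 : Tendsto (fun t => √(3 * halfWidth r t + c * halfWidth r t ^ 2)) (𝓝[<] 1) (𝓝 0) := by
    have h := ((hl.const_mul 3).add ((hl.pow 2).const_mul c)).sqrt
    simpa using h
  have h2 : Tendsto (fun t => a t * halfWidth r t * halfWidth r t) (𝓝[<] 1) (𝓝 0) := by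
    refine squeeze_zero_norm' ?_ h1
    filter_upwards [hmem] with t ht
    rw [Real.norm_eq_abs, ← Real.sqrt_sq_eq_abs]
    refine Real.sqrt_le_sqrt (le_of_eq ?_)
    linear_combination halfWidth r t ^ 2 * hc t ht + 4 * halfWidth r t * hp.mul_halfWidth ht
  refine ⟨(0 - c * 1) / 2 + C, ?_⟩
  have h3 : Tendsto (fun t : ℝ => t) (𝓝[<] 1) (𝓝 1) := nhdsWithin_le_nhds
  refine (((h2.sub (h3.const_mul c)).div_const 2).add_const C).congr' ?_
  filter_upwards [hmem] with t ht
  exact (hC t ht).symm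

/-- `r` is the nonnegative derivative of `k`, which has finite limits at both ends. This
integrability makes the energy of the explicit pair finite. -/
theorem integrableOn_r (hp : IsProfile r a k) {k₀ : ℝ} (hk : Tendsto k (𝓝[>] 0) (𝓝 k₀)) :
    IntegrableOn r (Ioo 0 1) := by
  obtain ⟨k₁, hk1⟩ := hp.exists_tendsto_k
  have hc : ContinuousOn k (Ioo 0 1) := fun t ht =>
    (hp.deriv_k t ht).continuousAt.continuousWithinAt
  have hd : ∀ t ∈ Ioo (0 : ℝ) 1, HasDerivAt (extendFrom (Ioo 0 1) k) (r t) t := by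
    intro t ht
    refine (hp.deriv_k t ht).congr_of_eventuallyEq ?_
    filter_upwards [isOpen_Ioo.mem_nhds ht] with s hs
    exact extendFrom_extends hc s hs
  exact (intervalIntegral.integrableOn_deriv_of_nonneg
    (continuousOn_Icc_extendFrom_Ioo hc hk hk1) hd
    fun t ht => (hp.pos t ht).le).mono_set Ioo_subset_Ioc_self

theorem antitoneOn_a (hp : IsProfile r a k) : AntitoneOn a (Ioo 0 1) := by
  refine antitoneOn_of_deriv_nonpos (convex_Ioo 0 1)
    (fun t ht => (hp.deriv_a t ht).continuousAt.continuousWithinAt) ?_ ?_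
  · rw [interior_Ioo]
    exact fun t ht => (hp.deriv_a t ht).differentiableAt.differentiableWithinAt
  · rw [interior_Ioo]
    intro t ht
    rw [(hp.deriv_a t ht).deriv]
    have := hp.pos t ht
    have h2 : 0 ≤ a t ^ 2 + 32 / 9 * r t ^ 3 := by positivity
    linarith

theorem antitoneOn_speed (hp : IsProfile r a k) :
    AntitoneOn (fun t => a t * halfWidth r t) (Ioo 0 1) := by
  refine antitoneOn_of_deriv_nonpos (convex_Ioo 0 1)
    (fun t ht => (hp.hasDerivAt_speed ht).continuousAt.continuousWithinAt) ?_ ?_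
  · rw [interior_Ioo]
    exact fun t ht => (hp.hasDerivAt_speed ht).differentiableAt.differentiableWithinAt
  · rw [interior_Ioo]
    intro t ht
    rw [(hp.hasDerivAt_speed ht).deriv]
    have h2 : 0 ≤ 8 / 3 * r t ^ 2 := by positivity
    linarith

/-- The half width is concave: between two times it grows by at least the final speed and by at
most the initial speed. -/
theorem halfWidth_sub (hp : IsProfile r a k) {s t : ℝ} (hs : s ∈ Ioo (0 : ℝ) 1)
    (ht : t ∈ Ioo (0 : ℝ) 1) (hst : s < t) :
    a t * halfWidth r t * (t - s) ≤ halfWidth r t - halfWidth r s ∧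
      halfWidth r t - halfWidth r s ≤ a s * halfWidth r s * (t - s) := by
  have hsub : Icc s t ⊆ Ioo 0 1 := Icc_subset_Ioo hs.1 ht.2
  obtain ⟨ξ, hξ, h⟩ := exists_hasDerivAt_eq_slope (halfWidth r) (fun t => a t * halfWidth r t) hst
    (fun x hx => (hp.hasDerivAt_halfWidth (hsub hx)).continuousAt.continuousWithinAt)
    (fun x hx => hp.hasDerivAt_halfWidth (hsub (Ioo_subset_Icc_self hx)))
  have hξ' := hsub (Ioo_subset_Icc_self hξ)
  have h0 : 0 < t - s := sub_pos.2 hst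
  rw [eq_div_iff h0.ne'] at h
  rw [← h]
  exact ⟨mul_le_mul_of_nonneg_right (hp.antitoneOn_speed hξ' ht hξ.2.le) h0.le,
    mul_le_mul_of_nonneg_right (hp.antitoneOn_speed hs hξ' hξ.1.le) h0.le⟩

/-- The tangent to the concave function `l` at time `t` lies above `l > 0`; continued back to time
`0` it gives `l - t l' ≥ 0`. -/
theorem a_mul_le (hp : IsProfile r a k) {t : ℝ} (ht : t ∈ Ioo (0 : ℝ) 1) : a t ≤ 1 / t := by
  have hl := hp.halfWidth_pos ht
  have h1 : ∀ s ∈ Ioo 0 t, a t * halfWidth r t * (t - s) ≤ halfWidth r t := fun s hs => by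
    have hs' : s ∈ Ioo (0 : ℝ) 1 := ⟨hs.1, hs.2.trans ht.2⟩
    have := (hp.halfWidth_sub hs' ht hs.2).1
    linarith [hp.halfWidth_pos hs']
  have hcont : Tendsto (fun s => a t * halfWidth r t * (t - s)) (𝓝[>] 0)
      (𝓝 (a t * halfWidth r t * (t - 0))) := by
    have : Continuous fun s => a t * halfWidth r t * (t - s) := by fun_prop
    exact this.continuousAt.tendsto.mono_left nhdsWithin_le_nhds
  have h2 := le_of_tendsto hcont (by filter_upwards [Ioo_mem_nhdsGT ht.1] with s hs using h1 s hs)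
  rw [le_div_iff₀ ht.1]
  refine le_of_mul_le_mul_right ?_ hl
  linarith

/-- The same with the tangent continued forward to time `1`. -/
theorem le_a_mul (hp : IsProfile r a k) {t : ℝ} (ht : t ∈ Ioo (0 : ℝ) 1) :
    -(1 / (1 - t)) ≤ a t := by
  have hl := hp.halfWidth_pos ht
  have h1 : ∀ s ∈ Ioo t 1, -halfWidth r t ≤ a t * halfWidth r t * (s - t) := fun s hs => by
    have hs' : s ∈ Ioo (0 : ℝ) 1 := ⟨ht.1.trans hs.1, hs.2⟩
    have := (hp.halfWidth_sub ht hs' hs.1).2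
    linarith [hp.halfWidth_pos hs']
  have hcont : Tendsto (fun s => a t * halfWidth r t * (s - t)) (𝓝[<] 1)
      (𝓝 (a t * halfWidth r t * (1 - t))) := by
    have : Continuous fun s => a t * halfWidth r t * (s - t) := by fun_prop
    exact this.continuousAt.tendsto.mono_left nhdsWithin_le_nhds
  have h2 := ge_of_tendsto hcont (by filter_upwards [Ioo_mem_nhdsLT ht.2] with s hs using h1 s hs)
  have h3 : 0 < 1 - t := sub_pos.2 ht.2
  rw [← neg_div, div_le_iff₀ h3]
  refine le_of_mul_le_mul_right ?_ hl
  linarith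

/-- Only the upper bound is singular near `0`: since `a` is nonincreasing, `a (1/2)` bounds it from
below. -/
theorem abs_a_le_zero (hp : IsProfile r a k) :
    ∀ t ∈ Ioo (0 : ℝ) (1 / 2), |a t| ≤ 1 / t + |a (1 / 2)| := by
  intro t ht
  have ht' : t ∈ Ioo (0 : ℝ) 1 := ⟨ht.1, by linarith [ht.2]⟩
  have h1 := hp.a_mul_le ht'
  have h2 := hp.antitoneOn_a ht' (by norm_num : (1 / 2 : ℝ) ∈ Ioo (0 : ℝ) 1) ht.2.le
  have h3 : 0 < 1 / t := one_div_pos.2 ht.1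
  rw [abs_le]
  constructor <;> linarith [neg_abs_le (a (1 / 2)), abs_nonneg (a (1 / 2))]

theorem abs_a_le_one (hp : IsProfile r a k) :
    ∀ t ∈ Ioo (1 / 2 : ℝ) 1, |a t| ≤ 1 / (1 - t) + |a (1 / 2)| := by
  intro t ht
  have ht' : t ∈ Ioo (0 : ℝ) 1 := ⟨by linarith [ht.1], ht.2⟩
  have h1 := hp.le_a_mul ht'
  have h2 := hp.antitoneOn_a (by norm_num : (1 / 2 : ℝ) ∈ Ioo (0 : ℝ) 1) ht' ht.1.le
  have h3 : 0 < 1 / (1 - t) := one_div_pos.2 (sub_pos.2 ht.2)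
  rw [abs_le]
  constructor <;> linarith [le_abs_self (a (1 / 2)), abs_nonneg (a (1 / 2))]

end IsProfile

/-! ### The self-similar density -/

/-- The probability density `(3/4) (1 - y²)₊`, of which all `ρ(·,t)` are rescalings. -/
def bumpDensity (y : ℝ) : ℝ := 3 / 4 * max (1 - y ^ 2) 0

/-- The probability measure with density `(3/4) (1 - y²)₊`. -/
def bumpMeasure : Measure ℝ := volume.withDensity fun y => ENNReal.ofReal (bumpDensity y)

theorem continuous_bumpDensity : Continuous bumpDensity := by
  unfold bumpDensity
  fun_prop

theorem bumpDensity_nonneg (y : ℝ) : 0 ≤ bumpDensity y := by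
  unfold bumpDensity
  positivity

theorem bumpDensity_eq_zero {y : ℝ} (hy : y ∉ Icc (-1 : ℝ) 1) : bumpDensity y = 0 := by
  have : 1 - y ^ 2 ≤ 0 := by
    by_contra h
    exact hy (abs_le.1 (sq_le_one_iff_abs_le_one y |>.1 (by linarith)))
  rw [bumpDensity, max_eq_right this, mul_zero]

theorem hasCompactSupport_bumpDensity : HasCompactSupport bumpDensity :=
  HasCompactSupport.intro isCompact_Icc fun _ hy => bumpDensity_eq_zero hy

theorem integral_bumpDensity : ∫ y, bumpDensity y = 1 := by
  rw [← setIntegral_eq_integral_of_forall_compl_eq_zero (s := Icc (-1 : ℝ) 1)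
    fun y hy => bumpDensity_eq_zero hy, integral_Icc_eq_integral_Ioc,
    ← intervalIntegral.integral_of_le (by norm_num)]
  have : ∫ y in (-1 : ℝ)..1, bumpDensity y = ∫ y in (-1 : ℝ)..1, 3 / 4 * (1 - y ^ 2) := by
    refine intervalIntegral.integral_congr fun y hy => ?_
    rw [uIcc_of_le (by norm_num)] at hy
    have h : 0 ≤ 1 - y ^ 2 := by nlinarith [hy.1, hy.2]
    rw [bumpDensity, max_eq_left h]
  rw [this, intervalIntegral.integral_const_mul, intervalIntegral.integral_sub
    intervalIntegrable_const (intervalIntegral.intervalIntegrable_pow 2)]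
  norm_num

instance : IsProbabilityMeasure bumpMeasure := by
  refine ⟨?_⟩
  rw [bumpMeasure, withDensity_apply _ MeasurableSet.univ, Measure.restrict_univ,
    ← ofReal_integral_eq_lintegral_ofReal
      (continuous_bumpDensity.integrable_of_hasCompactSupport hasCompactSupport_bumpDensity)
      (ae_of_all _ bumpDensity_nonneg), integral_bumpDensity, ENNReal.ofReal_one]

theorem integrable_bumpMeasure {g : ℝ → ℝ} (hg : Continuous g) : Integrable g bumpMeasure := by
  rw [bumpMeasure, integrable_withDensity_iff_integrable_smul'
    continuous_bumpDensity.measurable.ennreal_ofReal (ae_of_all _ fun _ => ENNReal.ofReal_lt_top)]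
  simp only [ENNReal.toReal_ofReal (bumpDensity_nonneg _)]
  exact (continuous_bumpDensity.smul hg).integrable_of_hasCompactSupport
    hasCompactSupport_bumpDensity.smul_right

/-- All the measures are dilations of one compactly supported measure. The factor `L t = 0` is
allowed and gives the Dirac mass, so the end times need no separate argument. -/
theorem continuousInP2_map_bumpMeasure {L : ℝ → ℝ} (hL : ContinuousOn L (Icc 0 1))
    {μ : ℝ → Measure ℝ} (hμ : ∀ t ∈ Icc (0 : ℝ) 1, μ t = bumpMeasure.map (L t * ·)) :
    ContinuousInP2 μ := by
  have hm : ∀ c : ℝ, Measurable (c * ·) := fun c => measurable_const_mul c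
  have hint : ∀ t ∈ Icc (0 : ℝ) 1, ∀ f : ℝ → ℝ, Continuous f →
      ∫ x, f x ∂(μ t) = ∫ y, f (L t * y) ∂bumpMeasure := fun t ht f hf => by
    rw [hμ t ht, integral_map (hm _).aemeasurable hf.aestronglyMeasurable]
  refine ⟨fun t ht => ?_, fun t ht => ?_, fun f hf ⟨C, hC⟩ => ?_⟩
  · rw [hμ t ht]
    exact Measure.isProbabilityMeasure_map (hm _).aemeasurable
  · rw [hμ t ht, integrable_map_measure (continuous_pow 2).aestronglyMeasurable (hm _).aemeasurable]
    exact integrable_bumpMeasure (by fun_prop)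
  · refine ContinuousOn.congr ?_ fun t ht => hint t ht f hf
    obtain ⟨K, hK⟩ := isCompact_Icc.exists_bound_of_continuousOn hL
    have hC0 : 0 ≤ C := by simpa using (abs_nonneg _).trans (hC 0)
    refine continuousOn_of_dominated (bound := fun y => C * (1 + K ^ 2 * y ^ 2))
      (fun t _ => (hf.comp (continuous_const_mul _)).aestronglyMeasurable)
      (fun t ht => ae_of_all _ fun y => ?_) (integrable_bumpMeasure (by fun_prop))
      (ae_of_all _ fun y => hf.comp_continuousOn (hL.mul continuousOn_const))
    refine (hC _).trans ?_
    have h1 : L t ^ 2 ≤ K ^ 2 := sq_le_sq' (neg_le_of_abs_le (hK t ht)) (le_of_abs_le (hK t ht))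
    rw [mul_pow]
    gcongr

theorem withDensity_rescaled_bump {R l : ℝ} (hl : 0 < l) (hRl : R * l = 3 / 4) :
    volume.withDensity (fun x => ENNReal.ofReal (R * max (1 - (x / l) ^ 2) 0))
      = bumpMeasure.map (l * ·) := by
  have hm : Measurable (l * · : ℝ → ℝ) := measurable_const_mul l
  have hf : Measurable fun x : ℝ => ENNReal.ofReal (R * max (1 - (x / l) ^ 2) 0) := by fun_prop
  ext E hE
  rw [Measure.map_apply hm hE, bumpMeasure, withDensity_apply _ hE, withDensity_apply _ (hm hE)]
  conv_lhs => rw [← Real.smul_map_volume_mul_left hl.ne']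
  rw [Measure.restrict_smul, lintegral_smul_measure, setLIntegral_map hE hf hm,
    smul_eq_mul, ← lintegral_const_mul' _ _ ENNReal.ofReal_ne_top, abs_of_pos hl]
  refine lintegral_congr fun y => ?_
  rw [← ENNReal.ofReal_mul hl.le, bumpDensity, ← hRl, mul_div_cancel_left₀ _ hl.ne']
  congr 1
  ring

/-! ### Admissibility of the explicit pair. -/

namespace IsProfile

variable {r a k : ℝ → ℝ}

theorem withDensity_rhoBar (hp : IsProfile r a k) {t : ℝ} (ht : t ∈ Ioo (0 : ℝ) 1) :
    volume.withDensity (fun x => ENNReal.ofReal (rhoBar r (x, t)))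
      = bumpMeasure.map (halfWidth r t * ·) := by
  simp only [rhoBar]
  exact withDensity_rescaled_bump (hp.halfWidth_pos ht) (hp.mul_halfWidth ht)

theorem rhoBar_nonneg (hp : IsProfile r a k) {p : ℝ × ℝ} (ht : p.2 ∈ Ioo (0 : ℝ) 1) :
    0 ≤ rhoBar r p :=
  mul_nonneg (hp.pos _ ht).le (le_max_right _ _)

theorem rhoBar_le (hp : IsProfile r a k) {p : ℝ × ℝ} (ht : p.2 ∈ Ioo (0 : ℝ) 1) :
    rhoBar r p ≤ r p.2 := by
  refine mul_le_of_le_one_right (hp.pos _ ht).le (max_le ?_ zero_le_one)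
  linarith [sq_nonneg (p.1 / halfWidth r p.2)]

theorem rhoBar_eq_zero (hp : IsProfile r a k) {p : ℝ × ℝ} (ht : p.2 ∈ Ioo (0 : ℝ) 1)
    (h : halfWidth r p.2 ≤ |p.1|) : rhoBar r p = 0 := by
  have hl := hp.halfWidth_pos ht
  have : 1 ≤ (p.1 / halfWidth r p.2) ^ 2 := by
    rw [one_le_sq_iff_one_le_abs, abs_div, abs_of_pos hl, one_le_div hl]
    exact h
  rw [rhoBar, max_eq_right (by linarith), mul_zero]

theorem continuousOn_r (hp : IsProfile r a k) : ContinuousOn r (Ioo 0 1) :=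
  fun t ht => (hp.deriv_r t ht).continuousAt.continuousWithinAt

theorem continuousOn_a (hp : IsProfile r a k) : ContinuousOn a (Ioo 0 1) :=
  fun t ht => (hp.deriv_a t ht).continuousAt.continuousWithinAt

theorem continuousOn_halfWidth (hp : IsProfile r a k) : ContinuousOn (halfWidth r) (Ioo 0 1) :=
  fun _ ht => (hp.hasDerivAt_halfWidth ht).continuousAt.continuousWithinAt

theorem continuousOn_rhoBar (hp : IsProfile r a k) : ContinuousOn (rhoBar r) (slab 0 1) := by
  have h1 : ContinuousOn (fun p : ℝ × ℝ => r p.2) (slab 0 1) :=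
    hp.continuousOn_r.comp continuous_snd.continuousOn fun p hp => hp.2
  have h2 : ContinuousOn (fun p : ℝ × ℝ => halfWidth r p.2) (slab 0 1) :=
    hp.continuousOn_halfWidth.comp continuous_snd.continuousOn fun p hp => hp.2
  have h3 : ContinuousOn (fun p : ℝ × ℝ => p.1 / halfWidth r p.2) (slab 0 1) :=
    continuous_fst.continuousOn.div h2 fun p h => (hp.halfWidth_pos h.2).ne'
  have h4 : ContinuousOn (fun p : ℝ × ℝ => 1 - (p.1 / halfWidth r p.2) ^ 2) (slab 0 1) :=
    continuousOn_const.sub (h3.pow 2)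
  exact h1.mul (h4.sup continuousOn_const)

theorem aestronglyMeasurable_of_continuousOn {f : ℝ × ℝ → ℝ} (hf : ContinuousOn f (slab 0 1)) :
    AEStronglyMeasurable f stripMeasure :=
  hf.aestronglyMeasurable (measurableSet_slab 0 1)

theorem ae_strip_mem : ∀ᵐ p ∂stripMeasure, p.2 ∈ Ioo (0 : ℝ) 1 := by
  filter_upwards [ae_restrict_mem (measurableSet_slab 0 1)] with p h using h.2

theorem slice_rhoBar (hp : IsProfile r a k) {t : ℝ} (ht : t ∈ Ioo (0 : ℝ) 1) {g : ℝ → ℝ}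
    (hg : Continuous g) : Integrable (fun x => g x * rhoBar r (x, t)) ∧
      ∫ x, g x * rhoBar r (x, t) = ∫ y, g (halfWidth r t * y) ∂bumpMeasure := by
  have hm : Measurable (halfWidth r t * ·) := measurable_const_mul _
  have hρ : Measurable fun x => ENNReal.ofReal (rhoBar r (x, t)) := by
    simp only [rhoBar]
    fun_prop
  have hfin : ∀ᵐ x : ℝ, ENNReal.ofReal (rhoBar r (x, t)) < ⊤ :=
    ae_of_all _ fun _ => ENNReal.ofReal_lt_top
  have e : (fun x => g x * rhoBar r (x, t))
      = fun x => (ENNReal.ofReal (rhoBar r (x, t))).toReal • g x := by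
    funext x
    rw [ENNReal.toReal_ofReal (hp.rhoBar_nonneg ht), smul_eq_mul, mul_comm]
  rw [e]
  constructor
  · rw [← integrable_withDensity_iff_integrable_smul' hρ hfin, hp.withDensity_rhoBar ht,
      integrable_map_measure hg.aestronglyMeasurable hm.aemeasurable]
    exact integrable_bumpMeasure (hg.comp (continuous_const_mul _))
  · rw [← integral_withDensity_eq_integral_toReal_smul hρ hfin, hp.withDensity_rhoBar ht,
      integral_map hm.aemeasurable hg.aestronglyMeasurable]

/-- Each slice of `ρ̄` has unit mass, so the `L¹` norm is that of `h`. -/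
theorem integrable_mul_rhoBar (hp : IsProfile r a k) {h : ℝ → ℝ} (hc : ContinuousOn h (Ioo 0 1))
    (hi : IntegrableOn h (Ioo 0 1)) : Integrable (fun p => h p.2 * rhoBar r p) stripMeasure := by
  have hm : AEStronglyMeasurable (fun p : ℝ × ℝ => h p.2 * rhoBar r p) stripMeasure :=
    aestronglyMeasurable_of_continuousOn
      ((hc.comp continuous_snd.continuousOn fun p hp => hp.2).mul hp.continuousOn_rhoBar)
  rw [stripMeasure_eq_prod] at hm ⊢
  rw [integrable_prod_iff' hm]
  have hmem : ∀ᵐ t ∂(volume.restrict (Ioo (0 : ℝ) 1)), t ∈ Ioo (0 : ℝ) 1 :=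
    ae_restrict_mem measurableSet_Ioo
  constructor
  · filter_upwards [hmem] with t ht
    exact (hp.slice_rhoBar ht continuous_const (g := fun _ => h t)).1
  · refine hi.abs.congr ?_
    filter_upwards [hmem] with t ht
    have := (hp.slice_rhoBar ht continuous_const (g := fun _ => |h t|)).2
    simp only [integral_const, probReal_univ, one_smul] at this
    rw [← this]
    refine integral_congr_ae (ae_of_all _ fun x => ?_)
    simp only [Real.norm_eq_abs, abs_mul, abs_of_nonneg (hp.rhoBar_nonneg (p := (x, t)) ht)]

/-- `ρ̄² ≤ r ρ̄`, and `r` is integrable in time. -/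
theorem memLp_rhoBar (hp : IsProfile r a k) (hr : IntegrableOn r (Ioo 0 1)) :
    MemLp (rhoBar r) 2 stripMeasure := by
  have hm := aestronglyMeasurable_of_continuousOn hp.continuousOn_rhoBar
  rw [memLp_two_iff_integrable_sq hm]
  refine (hp.integrable_mul_rhoBar hp.continuousOn_r hr).mono' (hm.pow 2) ?_
  filter_upwards [ae_strip_mem] with p ht
  have h0 := hp.rhoBar_nonneg ht
  rw [Real.norm_eq_abs, abs_of_nonneg (sq_nonneg _), sq]
  exact mul_le_mul_of_nonneg_right (hp.rhoBar_le ht) h0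

/-- On the support `(a x)² ≤ (a l)² = 4 r + c` by the energy identity. -/
theorem memLp_momentum (hp : IsProfile r a k) (hr : IntegrableOn r (Ioo 0 1)) :
    MemLp (fun p => |a p.2 * p.1| * √(rhoBar r p)) 2 stripMeasure := by
  have hac : ContinuousOn (fun p : ℝ × ℝ => a p.2) (slab 0 1) :=
    hp.continuousOn_a.comp continuous_snd.continuousOn fun p hp => hp.2
  have hm : AEStronglyMeasurable (fun p => |a p.2 * p.1| * √(rhoBar r p)) stripMeasure :=
    aestronglyMeasurable_of_continuousOn
      ((hac.mul continuous_fst.continuousOn).abs.mul hp.continuousOn_rhoBar.sqrt)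
  obtain ⟨c, hc⟩ := hp.exists_energy
  rw [memLp_two_iff_integrable_sq hm]
  refine (hp.integrable_mul_rhoBar (h := fun t => 4 * r t + c)
    ((continuousOn_const.mul hp.continuousOn_r).add continuousOn_const)
    ((hr.const_mul 4).add (integrableOn_const (by simp)))).mono' (hm.pow 2) ?_
  filter_upwards [ae_strip_mem] with p ht
  have h0 := hp.rhoBar_nonneg ht
  rw [Real.norm_eq_abs, abs_of_nonneg (sq_nonneg _), mul_pow, Real.sq_sqrt h0, sq_abs, ← hc p.2 ht]
  by_cases hx : halfWidth r p.2 ≤ |p.1|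
  · rw [hp.rhoBar_eq_zero ht hx, mul_zero, mul_zero]
  · refine mul_le_mul_of_nonneg_right ?_ h0
    rw [mul_pow, mul_pow, ← sq_abs p.1]
    have := (not_le.1 hx).le
    gcongr

end IsProfile

/-- With `M = max |A| |ρ|` one has `|β| ≤ M^(3/2)`, hence `|β|^(4/3) ≤ M² ≤ A² + ρ²`. -/
theorem memLp_four_thirds {A ρ β : ℝ × ℝ → ℝ} {μ : Measure (ℝ × ℝ)} (hA : MemLp A 2 μ)
    (hρ : MemLp ρ 2 μ) (hβ : AEStronglyMeasurable β μ) (h : ∀ᵐ p ∂μ, |β p| ≤ A p * √(ρ p)) :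
    MemLp β (4 / 3) μ := by
  have h43 : (4 / 3 : ℝ≥0∞).toReal = 4 / 3 := by simp
  have hne : (4 / 3 : ℝ≥0∞) ≠ 0 := by simp
  have htop : (4 / 3 : ℝ≥0∞) ≠ ⊤ := ENNReal.div_ne_top (by simp) (by simp)
  rw [← integrable_norm_rpow_iff hβ hne htop, h43]
  refine (hA.integrable_sq.add hρ.integrable_sq).mono'
    (hβ.norm.aemeasurable.pow_const _).aestronglyMeasurable ?_
  filter_upwards [h] with p hp
  rw [Real.norm_eq_abs, abs_of_nonneg (by positivity), Real.norm_eq_abs, Pi.add_apply]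
  set M := max |A p| |ρ p| with hM
  have hM0 : 0 ≤ M := (abs_nonneg _).trans (le_max_left _ _)
  have h1 : |β p| ≤ M ^ (3 / 2 : ℝ) := by
    calc |β p| ≤ A p * √(ρ p) := hp
      _ ≤ M * √M := by
        gcongr
        · exact (le_abs_self _).trans (le_max_left _ _)
        · exact (le_abs_self _).trans (le_max_right _ _)
      _ = M ^ (3 / 2 : ℝ) := by
        rw [Real.sqrt_eq_rpow, show (3 / 2 : ℝ) = 1 + 1 / 2 by norm_num,
          Real.rpow_add_of_nonneg hM0 (by norm_num) (by norm_num), Real.rpow_one]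
  calc |β p| ^ (4 / 3 : ℝ) ≤ (M ^ (3 / 2 : ℝ)) ^ (4 / 3 : ℝ) := by gcongr
    _ = M ^ 2 := by
      rw [← Real.rpow_mul hM0, ← Real.rpow_natCast]
      norm_num
    _ ≤ A p ^ 2 + ρ p ^ 2 := by
      rw [← sq_abs (A p), ← sq_abs (ρ p)]
      rcases max_choice |A p| |ρ p| with h2 | h2 <;> rw [hM, h2]
      · exact le_add_of_nonneg_right (sq_nonneg _)
      · exact le_add_of_nonneg_left (sq_nonneg _)

namespace IsProfile

variable {r a k : ℝ → ℝ}

theorem integrable_rhoBar (hp : IsProfile r a k) : Integrable (rhoBar r) stripMeasure := by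
  simpa using hp.integrable_mul_rhoBar (h := fun _ => 1) continuousOn_const
    (integrableOn_const (by simp))

/-- In Lagrangian coordinates `x = l(t) y` the weight is `bumpMeasure`, independent of time. Since
`l' = a l`, the integrand `G` is the derivative of `φ` along `t ↦ (l(t) y, t)`, so its time integral
vanishes for each `y`. -/
theorem continuityEq_rhoBar (hp : IsProfile r a k) {β : ℝ × ℝ → ℝ}
    (hβ : ∀ᵐ p ∂stripMeasure, β p = rhoBar r p * (a p.2 * p.1)) :
    ContinuityEq (rhoBar r) β := by
  intro φ h1 h2 h3
  have hφ : ∀ p, HasFDerivAt φ (fderiv ℝ φ p) p := fun p =>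
    ((h1.differentiable (by simp)) p).hasFDerivAt
  have hφ' : Continuous (fderiv ℝ φ) := h1.continuous_fderiv (by simp)
  set G : ℝ × ℝ → ℝ := fun p => fderiv ℝ φ p (0, 1) + a p.2 * p.1 * fderiv ℝ φ p (1, 0) with hG
  have hφt : Continuous fun p => fderiv ℝ φ p (0, 1) := hφ'.clm_apply continuous_const
  have hφx : Continuous fun p => fderiv ℝ φ p (1, 0) := hφ'.clm_apply continuous_const
  have hG0 : ∀ p, p ∉ tsupport φ → G p = 0 := fun p hpn => by
    simp only [hG, fderiv_of_notMem_tsupport ℝ hpn, zero_apply, mul_zero, add_zero]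
  have hac : ContinuousOn (fun p : ℝ × ℝ => a p.2) (slab 0 1) :=
    hp.continuousOn_a.comp continuous_snd.continuousOn fun p hp => hp.2
  have hGc : ContinuousOn G (slab 0 1) :=
    hφt.continuousOn.add ((hac.mul continuous_fst.continuousOn).mul hφx.continuousOn)
  obtain ⟨α, β', hα, hαβ, hβ1, hK⟩ := exists_Icc_of_isCompact (h2.isCompact.image continuous_snd)
    (by rintro _ ⟨p, hp, rfl⟩; exact (h3 hp).2)
  have hGt : ∀ p : ℝ × ℝ, p.2 ∉ Icc α β' → p ∉ tsupport φ := fun p hpn hps =>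
    hpn (hK (mem_image_of_mem _ hps))
  -- `a` may be unbounded near the end times, but the support of `φ` is compact in the open strip.
  obtain ⟨M, hM⟩ : ∃ M, ∀ p, |G p| ≤ M := by
    obtain ⟨M, hM⟩ := h2.isCompact.exists_bound_of_continuousOn (hGc.mono h3)
    refine ⟨max M 0, fun p => ?_⟩
    by_cases hps : p ∈ tsupport φ
    · exact (hM p hps).trans (le_max_left _ _)
    · rw [hG0 p hps, abs_zero]
      exact le_max_right _ _
  have hGi : Integrable (fun p => G p * rhoBar r p) stripMeasure :=
    hp.integrable_rhoBar.bdd_mul (c := M) (aestronglyMeasurable_of_continuousOn hGc)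
      (ae_of_all _ hM)
  have e1 : ∫ p, (rhoBar r p * fderiv ℝ φ p (0, 1) + β p * fderiv ℝ φ p (1, 0)) ∂stripMeasure
      = ∫ p, G p * rhoBar r p ∂stripMeasure := by
    refine integral_congr_ae ?_
    filter_upwards [hβ] with p hp
    rw [hp, hG]
    ring
  have hlc : ∀ y : ℝ, ContinuousOn (fun t => (halfWidth r t * y, t)) (Ioo 0 1) := fun y =>
    (hp.continuousOn_halfWidth.mul continuousOn_const).prodMk continuousOn_id
  rw [e1]
  rw [stripMeasure_eq_prod] at hGi ⊢
  rw [integral_prod_symm _ hGi]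
  have e2 : ∫ t in Ioo (0 : ℝ) 1, ∫ x, G (x, t) * rhoBar r (x, t)
      = ∫ t in Ioo (0 : ℝ) 1, ∫ y, G (halfWidth r t * y, t) ∂bumpMeasure := by
    refine setIntegral_congr_fun measurableSet_Ioo fun t ht => ?_
    refine (hp.slice_rhoBar ht (g := fun x => G (x, t)) ?_).2
    have c1 : Continuous fun x : ℝ => fderiv ℝ φ (x, t) (0, 1) := hφt.comp (Continuous.prodMk_left t)
    have c2 : Continuous fun x : ℝ => fderiv ℝ φ (x, t) (1, 0) := hφx.comp (Continuous.prodMk_left t)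
    simp only [hG]
    fun_prop
  rw [e2, integral_integral_swap]
  · refine integral_eq_zero_of_ae (ae_of_all _ fun y => ?_)
    -- A slightly larger interval, still inside `(0,1)`, at whose ends `φ` vanishes.
    set α₀ := α / 2
    set β₀ := (1 + β') / 2
    have hα₀ : 0 < α₀ := by positivity
    have hβ₀ : β₀ < 1 := by simp only [β₀]; linarith
    have hlt : α₀ ≤ β₀ := by simp only [α₀, β₀]; linarith
    have hα1 : α₀ < α := by simp only [α₀]; linarith
    have hβ2 : β' < β₀ := by simp only [β₀]; linarith
    have hsub : Icc α₀ β₀ ⊆ Ioo 0 1 := Icc_subset_Ioo hα₀ hβ₀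
    have hder : ∀ t ∈ Icc α₀ β₀, HasDerivAt (fun t => φ (halfWidth r t * y, t))
        (G (halfWidth r t * y, t)) t := by
      intro t ht
      have hl := (hp.hasDerivAt_halfWidth (hsub ht)).mul_const y
      have h4 := HasFDerivAt.comp_hasDerivAt (f := fun t => (halfWidth r t * y, t)) t
        (hφ (halfWidth r t * y, t)) (hl.prodMk (hasDerivAt_id' t))
      refine h4.congr_deriv ?_
      have : ((a t * halfWidth r t * y, 1) : ℝ × ℝ)
          = (0, 1) + (a t * (halfWidth r t * y)) • (1, 0) := by
        ext <;> simp
        ring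
      rw [this, map_add, map_smul, smul_eq_mul]
    have hz : ∀ t, t ∉ Icc α β' → φ (halfWidth r t * y, t) = 0 := fun t ht =>
      image_eq_zero_of_notMem_tsupport (hGt (_, t) ht)
    have e3 : ∫ t in Ioo (0 : ℝ) 1, G (halfWidth r t * y, t)
        = ∫ t in Icc α₀ β₀, G (halfWidth r t * y, t) := by
      refine setIntegral_eq_of_subset_of_forall_sdiff_eq_zero measurableSet_Ioo hsub fun t ht => ?_
      refine hG0 _ (hGt (_, t) fun ht' => ht.2 ?_)
      exact Icc_subset_Icc hα1.le hβ2.le ht'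
    simp only [Pi.zero_apply]
    rw [e3, integral_Icc_eq_integral_Ioc, ← intervalIntegral.integral_of_le hlt,
      intervalIntegral.integral_eq_sub_of_hasDerivAt
        (f := fun t => φ (halfWidth r t * y, t)) (by rwa [uIcc_of_le hlt])]
    · rw [hz β₀ fun h => absurd h.2 (not_le.2 hβ2), hz α₀ fun h => absurd h.1 (not_le.2 hα1),
        sub_zero]
    · refine ContinuousOn.intervalIntegrable ?_
      rw [uIcc_of_le hlt]
      exact hGc.comp ((hlc y).mono hsub) fun t ht => ⟨mem_univ _, hsub ht⟩
  · refine Integrable.of_bound (C := M) ?_ (ae_of_all _ fun p => hM _)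
    have : ((volume : Measure ℝ).restrict (Ioo 0 1)).prod bumpMeasure
        = ((volume : Measure ℝ).prod bumpMeasure).restrict (Ioo 0 1 ×ˢ univ) := by
      rw [← Measure.prod_restrict, Measure.restrict_univ]
    rw [this]
    refine ContinuousOn.aestronglyMeasurable ?_ (measurableSet_Ioo.prod MeasurableSet.univ)
    refine hGc.comp ?_ fun p hp => ⟨mem_univ _, hp.1⟩
    exact ((hp.continuousOn_halfWidth.comp continuous_fst.continuousOn fun p hp => hp.1).mul
      continuous_snd.continuousOn).prodMk continuous_fst.continuousOn

/-- A pair made of `ρ = r (1 - x²/l²)₊` and the flux `a x ρ` is admissible when the half width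
extends continuously to `[0,1]`, with the value `0` at time `1`. -/
theorem admissibleEta (hp : IsProfile r a k) (hr : IntegrableOn r (Ioo 0 1)) {L : ℝ → ℝ}
    (hL : ContinuousOn L (Icc 0 1)) (hLl : ∀ t ∈ Ioo (0 : ℝ) 1, L t = halfWidth r t)
    (hL1 : L 1 = 0) {d : Pair} (hcurve : ∀ t ∈ Icc (0 : ℝ) 1, d.curve t = bumpMeasure.map (L t * ·))
    (hdens : d.density = rhoBar r)
    (hbeta : ∀ p : ℝ × ℝ, p.2 ∈ Ioo (0 : ℝ) 1 → d.beta p = rhoBar r p * (a p.2 * p.1)) :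
    AdmissibleEta d := by
  have hβ : ∀ᵐ p ∂stripMeasure, d.beta p = rhoBar r p * (a p.2 * p.1) := by
    filter_upwards [ae_strip_mem] with p ht using hbeta p ht
  have hac : ContinuousOn (fun p : ℝ × ℝ => a p.2) (slab 0 1) :=
    hp.continuousOn_a.comp continuous_snd.continuousOn fun p hp => hp.2
  have hβm : AEStronglyMeasurable d.beta stripMeasure :=
    (aestronglyMeasurable_of_continuousOn
      (hp.continuousOn_rhoBar.mul (hac.mul continuous_fst.continuousOn))).congr
      (hβ.mono fun _ h => h.symm)
  have hbd : ∀ᵐ p ∂stripMeasure, |d.beta p| ≤ |a p.2 * p.1| * √(rhoBar r p) * √(rhoBar r p) := by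
    filter_upwards [hβ, ae_strip_mem] with p h1 h2
    have h0 := hp.rhoBar_nonneg h2
    rw [h1, mul_assoc, Real.mul_self_sqrt h0, abs_mul, abs_of_nonneg h0, mul_comm]
  have hA := hp.memLp_momentum hr
  have hρ := hp.memLp_rhoBar hr
  refine ⟨continuousInP2_map_bumpMeasure hL hcurve, ?_, ?_, ?_, ?_, ?_, ?_, ?_, ?_⟩
  · filter_upwards [ae_strip_mem] with p h2
    rw [hdens]
    exact hp.rhoBar_nonneg h2
  · filter_upwards [ae_restrict_mem measurableSet_Ioo] with t ht
    rw [hcurve t (Ioo_subset_Icc_self ht), hLl t ht, hdens, hp.withDensity_rhoBar ht]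
  · rwa [hdens]
  · exact memLp_four_thirds hA hρ hβm hbd
  · rw [hdens]
    exact hp.continuityEq_rhoBar hβ
  · rw [hcurve 1 ⟨zero_le_one, le_rfl⟩, hL1]
    simp
  · exact ⟨_, hA, by rwa [hdens]⟩
  · filter_upwards [hβ] with p h1 h2
    rw [hdens] at h2
    rw [h1, h2, zero_mul]

end IsProfile

/-! ### Calibration by `k + a x²/2` -/

/-- The density of the energy. -/
def Pair.energyDensity (d : Pair) (p : ℝ × ℝ) : ℝ :=
  1 / 2 * (d.density p ^ 2 + d.beta p ^ 2 / d.density p)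

/-- What a competitor loses against the profile: the function `k + a x²/2` solves the
Hamilton-Jacobi equation where `ρ > 0` and is a subsolution elsewhere. -/
def Pair.gap (r a : ℝ → ℝ) (d : Pair) (p : ℝ × ℝ) : ℝ :=
  1 / 2 * (d.density p - rhoBar r p) ^ 2
    + 1 / 2 * ((d.beta p - d.density p * (a p.2 * p.1)) ^ 2 / d.density p)
    + d.density p * (rhoBar r p - r p.2 * (1 - (p.1 / halfWidth r p.2) ^ 2))

theorem AdmissibleEta.integrable_energyDensity {d : Pair} (hd : AdmissibleEta d) :
    Integrable d.energyDensity stripMeasure := by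
  obtain ⟨A, hA, hb⟩ := hd.bound
  have hρ := hd.density_memLp
  refine ((hρ.integrable_sq.add hA.integrable_sq).const_mul (1 / 2)).mono' ?_ ?_
  · exact ((hρ.1.pow 2).add ((hd.beta_memLp.1.pow 2).div₀ hρ.1)).const_mul _
  · filter_upwards [hb, hd.density_nonneg] with p h1 h2
    have h3 : d.beta p ^ 2 / d.density p ≤ A p ^ 2 := by
      rcases h2.eq_or_lt with h0 | h0
      · rw [← h0, div_zero]
        positivity
      · rw [div_le_iff₀ h0, ← Real.sq_sqrt h2, ← mul_pow, ← sq_abs (d.beta p)]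
        gcongr
    have h4 : 0 ≤ d.beta p ^ 2 / d.density p := by positivity
    rw [Pair.energyDensity, Real.norm_eq_abs, abs_of_nonneg (by positivity), Pi.add_apply]
    linarith

namespace IsProfile

variable {r a k : ℝ → ℝ} {d : Pair}

theorem gap_nonneg (hp : IsProfile r a k) (hd : AdmissibleEta d) :
    ∀ᵐ p ∂stripMeasure, 0 ≤ d.gap r a p := by
  filter_upwards [hd.density_nonneg, ae_strip_mem] with p h1 h2
  have h3 : r p.2 * (1 - (p.1 / halfWidth r p.2) ^ 2) ≤ rhoBar r p :=
    mul_le_mul_of_nonneg_left (le_max_left _ _) (hp.pos _ h2).le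
  have h4 := mul_nonneg h1 (sub_nonneg.2 h3)
  have h5 : 0 ≤ (d.beta p - d.density p * (a p.2 * p.1)) ^ 2 / d.density p := by positivity
  unfold Pair.gap
  positivity

/-- The subtracted bracket is `ρ ∂ₜv + β ∂ₓv` for `v = k + a x²/2`; the products `ρ ρ̄` from the
square and from the last term of the gap cancel. -/
theorem gap_eq (hp : IsProfile r a k) (hd : AdmissibleEta d) : ∀ᵐ p ∂stripMeasure,
    d.gap r a p = d.energyDensity p + 1 / 2 * rhoBar r p ^ 2
      - (r p.2 * d.density p
        + -(a p.2 ^ 2 + 32 / 9 * r p.2 ^ 3) / 2 * (p.1 ^ 2 * d.density p)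
        + a p.2 / 2 * (2 * (p.1 * d.beta p))) := by
  filter_upwards [hd.density_nonneg, hd.beta_zero, ae_strip_mem] with p h1 h2 h3
  have h4 : r p.2 * (1 - (p.1 / halfWidth r p.2) ^ 2) = r p.2 - 16 / 9 * r p.2 ^ 3 * p.1 ^ 2 := by
    have := (hp.pos _ h3).ne'
    unfold halfWidth
    field_simp
    ring
  rw [Pair.gap, Pair.energyDensity, h4]
  -- Where `ρ = 0` the flux vanishes too, and both quotients are `0 / 0 = 0`.
  rcases h1.eq_or_lt with h0 | h0
  · rw [h2 h0.symm, ← h0]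
    ring
  · field_simp
    ring

/-- The loss on a slab, computed with the moment equation. -/
theorem integral_gap_slab (hp : IsProfile r a k) (hr : IntegrableOn r (Ioo 0 1))
    (hd : AdmissibleEta d) {s t : ℝ} (hs : 0 < s) (hst : s ≤ t) (ht : t < 1) :
    IntegrableOn (d.gap r a) (slab s t) stripMeasure ∧
    ∫ p in slab s t, d.gap r a p ∂stripMeasure
      = (∫ p in slab s t, (d.energyDensity p + 1 / 2 * rhoBar r p ^ 2) ∂stripMeasure)
        - ((k t + 1 / 2 * (a t * d.moment t)) - (k s + 1 / 2 * (a s * d.moment s))) := by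
  have hsub : Icc s t ⊆ Ioo 0 1 := Icc_subset_Ioo hs ht
  set a' : ℝ → ℝ := fun τ => -(a τ ^ 2 + 32 / 9 * r τ ^ 3) with ha'
  have hrc : ContinuousOn r (Icc s t) := hp.continuousOn_r.mono hsub
  have hac : ContinuousOn a (Icc s t) := hp.continuousOn_a.mono hsub
  have ha'c : ContinuousOn a' (Icc s t) :=
    ((hac.pow 2).add (continuousOn_const.mul (hrc.pow 3))).neg
  have ha'2 : ContinuousOn (fun τ => a' τ / 2) (Icc s t) := ha'c.div_const 2
  have ha2 : ContinuousOn (fun τ => a τ / 2) (Icc s t) := hac.div_const 2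
  have F1 := hd.integrable_density
  have F2 := hd.integrable_sq_mul_density
  have F3 : Integrable (fun p => 2 * (p.1 * d.beta p)) stripMeasure :=
    hd.integrable_mul_beta.const_mul 2
  have i1 := integrableOn_slab_mul F1 hrc
  have i2 := integrableOn_slab_mul F2 ha'2
  have i3 := integrableOn_slab_mul F3 ha2
  have i0 : Integrable (fun p => d.energyDensity p + 1 / 2 * rhoBar r p ^ 2) stripMeasure :=
    hd.integrable_energyDensity.add ((hp.memLp_rhoBar hr).integrable_sq.const_mul _)
  have hg := ae_restrict_of_ae (s := slab s t) (hp.gap_eq hd)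
  have i12 : IntegrableOn (fun p => r p.2 * d.density p + a' p.2 / 2 * (p.1 ^ 2 * d.density p))
      (slab s t) stripMeasure := i1.add i2
  have i123 : IntegrableOn (fun p => r p.2 * d.density p + a' p.2 / 2 * (p.1 ^ 2 * d.density p)
      + a p.2 / 2 * (2 * (p.1 * d.beta p))) (slab s t) stripMeasure := i12.add i3
  refine ⟨(i0.integrableOn.sub i123).congr (hg.mono fun _ h => h.symm), ?_⟩
  rw [integral_congr_ae hg, integral_sub i0.integrableOn i123, integral_add i12 i3,
    integral_add i1 i2, setIntegral_slab F1 hs.le hst ht.le hrc,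
    setIntegral_slab F2 hs.le hst ht.le ha'2, setIntegral_slab F3 hs.le hst ht.le ha2]
  have e1 : ∫ τ in s..t, r τ * ∫ x, d.density (x, τ) = k t - k s := by
    rw [integral_congr_of_ae_strip hs.le hst ht.le (g := r) (by
      filter_upwards [hd.slice_mass] with τ h
      rw [h, mul_one])]
    refine intervalIntegral.integral_eq_sub_of_hasDerivAt (fun x hx => hp.deriv_k x (hsub ?_))
      (hrc.intervalIntegrable_of_Icc hst)
    rwa [uIcc_of_le hst] at hx
  have e2 : ∫ τ in s..t, a' τ / 2 * ∫ x, x ^ 2 * d.density (x, τ)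
      = ∫ τ in s..t, a' τ / 2 * d.moment τ :=
    integral_congr_of_ae_strip hs.le hst ht.le (by
      filter_upwards [hd.slice_moment] with τ h
      rw [h])
  have e3 := hd.mul_moment_sub hs.le hst ht.le (a := fun τ => a τ / 2) (a' := fun τ => a' τ / 2)
    (fun x hx => (hp.deriv_a x (hsub hx)).div_const 2) ha'2
  have hmi : IntervalIntegrable (fun τ => a' τ / 2 * d.moment τ) volume s t :=
    (ha'2.mul (hd.continuousOn_moment.mono
      (Icc_subset_Icc hs.le ht.le))).intervalIntegrable_of_Icc hst
  have hbi : IntervalIntegrable (fun τ => a τ / 2 * d.momentRate τ) volume s t :=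
    (hd.intervalIntegrable_momentRate.mono_set (by
      rw [uIcc_of_le hst, uIcc_of_le zero_le_one]
      exact Icc_subset_Icc hs.le ht.le)).continuousOn_mul (by rwa [uIcc_of_le hst])
  rw [intervalIntegral.integral_add hmi hbi] at e3
  have e4 : ∫ τ in s..t, a τ / 2 * ∫ x, 2 * (x * d.beta (x, τ))
      = ∫ τ in s..t, a τ / 2 * d.momentRate τ := rfl
  simp only at e3 ⊢
  rw [e1, e2, e4]
  linarith

end IsProfile

/-- An increasing sequence of slabs that fills the strip. -/
def slabSeq (n : ℕ) : Set (ℝ × ℝ) := slab (1 / ((n : ℝ) + 3)) (1 - 1 / ((n : ℝ) + 3))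

theorem monotone_slabSeq : Monotone slabSeq := by
  intro m n hmn
  have h : (1 : ℝ) / (n + 3) ≤ 1 / (m + 3) := by
    have : (m : ℝ) ≤ n := by exact_mod_cast hmn
    gcongr
  exact prod_mono_right (Ioo_subset_Ioo h (by linarith))

theorem tendsto_one_div_add_three :
    Tendsto (fun n : ℕ => 1 / ((n : ℝ) + 3)) atTop (𝓝[>] 0) := by
  refine tendsto_nhdsWithin_iff.2 ⟨?_, Eventually.of_forall fun n => ?_⟩
  · exact tendsto_const_nhds.div_atTop
      (tendsto_atTop_add_const_right _ _ tendsto_natCast_atTop_atTop)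
  · exact mem_Ioi.2 (by positivity)

theorem iUnion_slabSeq : ⋃ n, slabSeq n = slab 0 1 := by
  refine subset_antisymm (iUnion_subset fun n => ?_) fun p hp => ?_
  · have h : (0 : ℝ) ≤ 1 / (n + 3) := by positivity
    exact prod_mono_right (Ioo_subset_Ioo h (by linarith))
  · have h1 := tendsto_one_div_add_three.mono_right nhdsWithin_le_nhds
    obtain ⟨n, hn1, hn2⟩ := ((h1.eventually_lt_const hp.2.1).and
      (h1.eventually_lt_const (sub_pos.2 hp.2.2))).exists
    exact mem_iUnion.2 ⟨n, mem_univ _, hn1, by linarith⟩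

/-! ### Exhaustion of the strip, minimality and uniqueness. -/

namespace IsProfile

variable {r a k : ℝ → ℝ} {d : Pair}

theorem integrableOn_gap_slabSeq (hp : IsProfile r a k) (hr : IntegrableOn r (Ioo 0 1))
    (hd : AdmissibleEta d) (n : ℕ) : IntegrableOn (d.gap r a) (slabSeq n) stripMeasure := by
  -- The shift by `3` keeps the lower time of the slab below the upper one for every `n`.
  have h1 : (1 : ℝ) / (n + 3) ≤ 1 / 3 := by
    gcongr
    linarith [(Nat.cast_nonneg n : (0 : ℝ) ≤ n)]
  have h0 : (0 : ℝ) < 1 / (n + 3) := by positivity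
  exact (hp.integral_gap_slab hr hd h0 (by linarith) (by linarith)).1

/-- The slabs avoid the end times, where `a` and `r` may be singular. At time `1` the term `a m`
disappears in the limit; the limit `B` at time `0` is left free, since it distinguishes the two
problems. -/
theorem tendsto_integral_gap (hp : IsProfile r a k) (hr : IntegrableOn r (Ioo 0 1))
    (hd : AdmissibleEta d) {k₁ B : ℝ} (hk1 : Tendsto k (𝓝[<] 1) (𝓝 k₁))
    (hB : Tendsto (fun t => k t + 1 / 2 * (a t * d.moment t)) (𝓝[>] 0) (𝓝 B)) :
    Tendsto (fun n => ∫ p in slabSeq n, d.gap r a p ∂stripMeasure) atTop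
      (𝓝 (energy d + (∫ p, 1 / 2 * rhoBar r p ^ 2 ∂stripMeasure) - (k₁ - B))) := by
  have i1 := hd.integrable_energyDensity
  have i2 : Integrable (fun p => 1 / 2 * rhoBar r p ^ 2) stripMeasure :=
    (hp.memLp_rhoBar hr).integrable_sq.const_mul _
  have h1 := tendsto_setIntegral_of_monotone (μ := stripMeasure) (s := slabSeq)
    (f := fun p => d.energyDensity p + 1 / 2 * rhoBar r p ^ 2)
    (fun n => measurableSet_slab _ _) monotone_slabSeq (i1.add i2).integrableOn
  rw [iUnion_slabSeq, stripMeasure_restrict_slab_zero_one, integral_add i1 i2] at h1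
  have h2 := (hd.tendsto_mul_moment_one (abs_nonneg _) hp.abs_a_le_one).const_mul (1 / 2)
  have h3 := hk1.add h2
  rw [mul_zero, add_zero] at h3
  have h4 : Tendsto (fun n : ℕ => 1 - 1 / ((n : ℝ) + 3)) atTop (𝓝[<] 1) := by
    refine tendsto_nhdsWithin_iff.2 ⟨?_, Eventually.of_forall fun n => ?_⟩
    · simpa using (tendsto_one_div_add_three.mono_right nhdsWithin_le_nhds).const_sub 1
    · have : (0 : ℝ) < 1 / (n + 3) := by positivity
      exact mem_Iio.2 (by linarith)
  refine (h1.sub ((h3.comp h4).sub (hB.comp tendsto_one_div_add_three))).congr fun n => ?_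
  have h6 : (1 : ℝ) / (n + 3) ≤ 1 / 3 := by
    gcongr
    linarith [(Nat.cast_nonneg n : (0 : ℝ) ≤ n)]
  have h0 : (0 : ℝ) < 1 / (n + 3) := by positivity
  exact ((hp.integral_gap_slab hr hd h0 (by linarith) (by linarith)).2).symm

/-- Where `ρ̄` is not zero, the positive part in its definition is inactive. -/
theorem gap_eq_zero_of_rhoBar (hdens : d.density = rhoBar r)
    (hbeta : ∀ p : ℝ × ℝ, p.2 ∈ Ioo (0 : ℝ) 1 → d.beta p = rhoBar r p * (a p.2 * p.1)) :
    ∀ᵐ p ∂stripMeasure, d.gap r a p = 0 := by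
  filter_upwards [ae_strip_mem] with p h
  rw [Pair.gap, hbeta p h, hdens]
  have : rhoBar r p * (rhoBar r p - r p.2 * (1 - (p.1 / halfWidth r p.2) ^ 2)) = 0 := by
    rw [rhoBar]
    rcases max_choice (1 - (p.1 / halfWidth r p.2) ^ 2) 0 with h | h <;> rw [h] <;> ring
  rw [this]
  ring

end IsProfile

/-- The densities determine the measures at almost every time; continuity against bounded continuous
functions carries this to all times, end points included. -/
theorem curve_eq_of_density_ae_eq {c d : Pair} (hc : AdmissibleEta c) (hd : AdmissibleEta d)
    (h : d.density =ᵐ[stripMeasure] c.density) : ∀ t ∈ Icc (0 : ℝ) 1, d.curve t = c.curve t := by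
  have hae : ∀ᵐ t ∂(volume.restrict (Icc (0 : ℝ) 1)), d.curve t = c.curve t := by
    rw [← restrict_Ioo_eq_restrict_Icc]
    filter_upwards [hc.curve_eq, hd.curve_eq, ae_slice h] with t h1 h2 h3
    rw [h1, h2]
    refine withDensity_congr_ae ?_
    filter_upwards [h3] with x hx
    rw [hx]
  intro t ht
  have := hd.curve_cont.prob t ht
  have := hc.curve_cont.prob t ht
  refine ext_of_forall_integral_eq_of_IsFiniteMeasure fun f => ?_
  have hf : ∃ C : ℝ, ∀ x, |f x| ≤ C * (1 + x ^ 2) := ⟨‖f‖, fun x =>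
    (f.norm_coe_le_norm x).trans (le_mul_of_one_le_right (norm_nonneg _)
      (by linarith [sq_nonneg x]))⟩
  exact Measure.eqOn_Icc_of_ae_eq volume (by norm_num) (hae.mono fun t h => by simp only [h])
    (hd.curve_cont.cont f f.continuous hf) (hc.curve_cont.cont f f.continuous hf) ht

namespace IsProfile

variable {r a k : ℝ → ℝ}

/-- Common to both problems: `J` enters only through its difference with `energy`, which must be the
boundary term at time `0`. -/
theorem isUniqueMinimizer (hp : IsProfile r a k) (hr : IntegrableOn r (Ioo 0 1)) {S : Pair → Prop}
    {J : Pair → ℝ} {c : Pair} (hc : S c) (hS : ∀ d, S d → AdmissibleEta d ∧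
      Tendsto (fun t => k t + 1 / 2 * (a t * d.moment t)) (𝓝[>] 0) (𝓝 (J d - energy d)))
    (hdens : c.density = rhoBar r)
    (hbeta : ∀ p : ℝ × ℝ, p.2 ∈ Ioo (0 : ℝ) 1 → c.beta p = rhoBar r p * (a p.2 * p.1)) :
    IsUniqueMinimizer S J c := by
  obtain ⟨k₁, hk1⟩ := hp.exists_tendsto_k
  have hc0 := gap_eq_zero_of_rhoBar hdens hbeta
  -- The gap of `c` vanishes, so `c` itself determines the constant in the limit and no energy has
  -- to be computed.
  have hJc : J c + (∫ p, 1 / 2 * rhoBar r p ^ 2 ∂stripMeasure) - k₁ = 0 := by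
    have h := hp.tendsto_integral_gap hr (hS c hc).1 hk1 (hS c hc).2
    have h0 : ∀ n, ∫ p in slabSeq n, c.gap r a p ∂stripMeasure = 0 := fun n =>
      integral_eq_zero_of_ae (ae_restrict_of_ae hc0)
    simp only [h0] at h
    linarith [tendsto_nhds_unique h tendsto_const_nhds]
  have hlim : ∀ d, S d → Tendsto (fun n => ∫ p in slabSeq n, d.gap r a p ∂stripMeasure) atTop
      (𝓝 (J d - J c)) := fun d hd => by
    have h := hp.tendsto_integral_gap hr (hS d hd).1 hk1 (hS d hd).2
    have e : energy d + (∫ p, 1 / 2 * rhoBar r p ^ 2 ∂stripMeasure) - (k₁ - (J d - energy d))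
        = J d - J c := by linarith
    rwa [e] at h
  have hnn : ∀ d, S d → ∀ n, 0 ≤ ∫ p in slabSeq n, d.gap r a p ∂stripMeasure := fun d hd n =>
    integral_nonneg_of_ae (ae_restrict_of_ae (hp.gap_nonneg (hS d hd).1))
  refine ⟨hc, fun d hd => ?_, fun d hd hmin => ?_⟩
  · exact sub_nonneg.1 (ge_of_tendsto' (hlim d hd) (hnn d hd))
  · have hda := (hS d hd).1
    -- For another minimizer the nonnegative, nondecreasing slab integrals have a limit `≤ 0`, so
    -- each of them is zero.
    have hmono : Monotone fun n => ∫ p in slabSeq n, d.gap r a p ∂stripMeasure := fun m n hmn =>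
      setIntegral_mono_set (hp.integrableOn_gap_slabSeq hr hda n)
        (ae_restrict_of_ae (hp.gap_nonneg hda)) (monotone_slabSeq hmn).eventuallyLE
    have hz : ∀ n, ∀ᵐ p ∂stripMeasure, p ∈ slabSeq n → d.gap r a p = 0 := fun n => by
      have h1 := hmono.ge_of_tendsto (hlim d hd) n
      have h2 := hmin c hc
      have h3 : ∫ p in slabSeq n, d.gap r a p ∂stripMeasure = 0 :=
        le_antisymm (by linarith) (hnn d hd n)
      rw [setIntegral_eq_zero_iff_of_nonneg_ae (ae_restrict_of_ae (hp.gap_nonneg hda))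
        (hp.integrableOn_gap_slabSeq hr hda n)] at h3
      exact (ae_restrict_iff' (measurableSet_slab _ _)).1 h3
    have key : ∀ᵐ p ∂stripMeasure, d.density p = c.density p ∧ d.beta p = c.beta p := by
      filter_upwards [ae_all_iff.2 hz, ae_strip_mem, hda.density_nonneg, hda.beta_zero]
        with p h1 h2 h3 h4
      have hmem : p ∈ ⋃ n, slabSeq n := by
        rw [iUnion_slabSeq]
        exact ⟨mem_univ _, h2⟩
      obtain ⟨n, hn⟩ := mem_iUnion.1 hmem
      have h5 := h1 n hn
      have h6 : r p.2 * (1 - (p.1 / halfWidth r p.2) ^ 2) ≤ rhoBar r p :=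
        mul_le_mul_of_nonneg_left (le_max_left _ _) (hp.pos _ h2).le
      have h7 := mul_nonneg h3 (sub_nonneg.2 h6)
      have h8 : 0 ≤ (d.beta p - d.density p * (a p.2 * p.1)) ^ 2 / d.density p := by positivity
      have h9 := sq_nonneg (d.density p - rhoBar r p)
      rw [Pair.gap] at h5
      have h10 : (d.density p - rhoBar r p) ^ 2 = 0 := by linarith
      have h11 : (d.beta p - d.density p * (a p.2 * p.1)) ^ 2 / d.density p = 0 := by linarith
      have h12 : d.density p = rhoBar r p := sub_eq_zero.1 (pow_eq_zero_iff two_ne_zero |>.1 h10)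
      refine ⟨by rw [h12, hdens], ?_⟩
      rw [hbeta p h2, ← h12]
      rcases div_eq_zero_iff.1 h11 with h | h
      · exact sub_eq_zero.1 (pow_eq_zero_iff two_ne_zero |>.1 h)
      · rw [h4 h, h, zero_mul]
    have hden : d.density =ᵐ[stripMeasure] c.density := key.mono fun _ h => h.1
    exact ⟨curve_eq_of_density_ae_eq (hS c hc).1 hda hden, hden, key.mono fun _ h => h.2⟩

end IsProfile

/-! ### The minimizers -/

theorem map_zero_mul_bumpMeasure : bumpMeasure.map ((0 : ℝ) * ·) = Measure.dirac 0 := by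
  simp

-- For `|x| ≥ l` the factor `ρ̄` vanishes, so neither the continuation of `u` nor its
-- differentiability at `|x| = l` matters.
open Classical in
theorem flux_rhoBar_valueFn {r a k : ℝ → ℝ} (hp : IsProfile r a k) (far : ℝ × ℝ → ℝ) {p : ℝ × ℝ}
    (ht : p.2 ∈ Ioo (0 : ℝ) 1) :
    flux (rhoBar r) (valueFn far r a k) p = rhoBar r p * (a p.2 * p.1) := by
  by_cases hx : halfWidth r p.2 ≤ |p.1|
  · rw [flux, hp.rhoBar_eq_zero ht hx, zero_mul, zero_mul]
  · have hev : (fun x => valueFn far r a k (x, p.2)) =ᶠ[𝓝 p.1]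
        fun x => k p.2 + a p.2 * x ^ 2 / 2 := by
      filter_upwards [(isOpen_lt continuous_abs continuous_const).mem_nhds (not_le.1 hx)] with x h
      exact if_pos (le_of_lt h)
    have hder : HasDerivAt (fun x : ℝ => k p.2 + a p.2 * x ^ 2 / 2) (a p.2 * p.1) p.1 := by
      refine (((hasDerivAt_pow 2 p.1).const_mul (a p.2)).div_const 2 |>.const_add _).congr_deriv ?_
      norm_num
      ring
    rw [flux, hev.deriv_eq, hder.deriv]

/-- A function that is continuous on `(0,1)` and has its values at the end points as limits is
continuous on `[0,1]`. -/
theorem continuousOn_Icc_of_tendsto {L : ℝ → ℝ} (hL : ContinuousOn L (Ioo 0 1))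
    (h0 : Tendsto L (𝓝[>] 0) (𝓝 (L 0))) (h1 : Tendsto L (𝓝[<] 1) (𝓝 (L 1))) :
    ContinuousOn L (Icc 0 1) := by
  intro t ht
  rcases ht.1.eq_or_lt with rfl | ht0
  · rw [continuousWithinAt_Icc_iff_Ici zero_lt_one]
    exact continuousWithinAt_Ioi_iff_Ici.1 h0
  rcases ht.2.eq_or_lt with rfl | ht1
  · rw [continuousWithinAt_Icc_iff_Iic zero_lt_one]
    exact continuousWithinAt_Iio_iff_Iic.1 h1
  · exact (hL.continuousAt (isOpen_Ioo.mem_nhds ⟨ht0, ht1⟩)).continuousWithinAt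

open Classical in
theorem IsPlanningProfile.isUniqueMinimizer {r a k : ℝ → ℝ} (hp : IsPlanningProfile r a k) :
    IsUniqueMinimizer Admissible energy (planningPair r a k) := by
  have hq := hp.toIsProfile
  have hr := hq.integrableOn_r hp.k_zero
  have hbeta : ∀ p : ℝ × ℝ, p.2 ∈ Ioo (0 : ℝ) 1 →
      (planningPair r a k).beta p = rhoBar r p * (a p.2 * p.1) :=
    fun p ht => flux_rhoBar_valueFn hq _ ht
  set L : ℝ → ℝ := fun t => if t ∈ Ioo (0 : ℝ) 1 then halfWidth r t else 0 with hLdef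
  have hLl : ∀ t ∈ Ioo (0 : ℝ) 1, L t = halfWidth r t := fun t ht => if_pos ht
  have hL0 : L 0 = 0 := if_neg (by simp)
  have hL1 : L 1 = 0 := if_neg (by simp)
  have hL : ContinuousOn L (Icc 0 1) := by
    refine continuousOn_Icc_of_tendsto (hq.continuousOn_halfWidth.congr hLl) ?_ ?_
    · rw [hL0]
      refine (IsProfile.tendsto_halfWidth hp.r_zero).congr' ?_
      filter_upwards [Ioo_mem_nhdsGT zero_lt_one] with t ht using (hLl t ht).symm
    · rw [hL1]
      refine (IsProfile.tendsto_halfWidth hp.r_one).congr' ?_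
      filter_upwards [Ioo_mem_nhdsLT zero_lt_one] with t ht using (hLl t ht).symm
  have hcurve : ∀ t ∈ Icc (0 : ℝ) 1, (planningPair r a k).curve t = bumpMeasure.map (L t * ·) := by
    intro t _
    by_cases ht : t ∈ Ioo (0 : ℝ) 1
    · rw [hLl t ht, ← hq.withDensity_rhoBar ht]
      exact if_pos ht
    · rw [show L t = 0 from if_neg ht, map_zero_mul_bumpMeasure]
      exact if_neg ht
  have hadm : AdmissibleEta (planningPair r a k) :=
    hq.admissibleEta hr hL hLl hL1 hcurve rfl hbeta
  refine hq.isUniqueMinimizer hr ⟨hadm, if_neg (by simp)⟩ (fun d hd => ⟨hd.toAdmissibleEta, ?_⟩)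
    rfl hbeta
  have h := hd.toAdmissibleEta.tendsto_mul_moment_zero hd.initial (abs_nonneg _) hq.abs_a_le_zero
  have e : energy d - energy d = 0 + 1 / 2 * 0 := by ring
  rw [e]
  exact hp.k_zero.add (h.const_mul (1 / 2))

open Classical in
theorem IsRegularizedProfile.isUniqueMinimizer {η : ℝ} {r a k : ℝ → ℝ}
    (hp : IsRegularizedProfile η r a k) :
    IsUniqueMinimizer AdmissibleEta (energyEta η) (regularizedPair η r a k) := by
  have hq := hp.toIsProfile
  have h0 : (0 : ℝ) ∈ Ico (0 : ℝ) 1 := ⟨le_rfl, zero_lt_one⟩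
  have hIoo : 𝓝[>] (0 : ℝ) ≤ 𝓝[Ico 0 1] 0 := nhdsWithin_le_of_mem (Ico_mem_nhdsGT zero_lt_one)
  have hk0 : Tendsto k (𝓝[>] 0) (𝓝 0) := by
    have := (hp.cont_k 0 h0).tendsto.mono_left hIoo
    rwa [hp.k_zero] at this
  have ha0 : Tendsto a (𝓝[>] 0) (𝓝 (1 / η)) := by
    have := (hp.cont_a 0 h0).tendsto.mono_left hIoo
    rwa [hp.a_zero] at this
  have hr0 : Tendsto (halfWidth r) (𝓝[>] 0) (𝓝 (halfWidth r 0)) :=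
    tendsto_const_nhds.div (((hp.cont_r 0 h0).tendsto.mono_left hIoo).const_mul 4)
      (mul_ne_zero four_ne_zero hp.pos_zero.ne')
  have hr := hq.integrableOn_r hk0
  have hbeta : ∀ p : ℝ × ℝ, p.2 ∈ Ioo (0 : ℝ) 1 →
      (regularizedPair η r a k).beta p = rhoBar r p * (a p.2 * p.1) :=
    fun p ht => flux_rhoBar_valueFn hq _ ht
  set L : ℝ → ℝ := fun t => if t ∈ Ico (0 : ℝ) 1 then halfWidth r t else 0 with hLdef
  have hLl' : ∀ t ∈ Ico (0 : ℝ) 1, L t = halfWidth r t := fun t ht => if_pos ht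
  have hLl : ∀ t ∈ Ioo (0 : ℝ) 1, L t = halfWidth r t := fun t ht => hLl' t (Ioo_subset_Ico_self ht)
  have hL1 : L 1 = 0 := if_neg (by simp)
  have hL : ContinuousOn L (Icc 0 1) := by
    refine continuousOn_Icc_of_tendsto (hq.continuousOn_halfWidth.congr hLl) ?_ ?_
    · rw [hLl' 0 h0]
      refine hr0.congr' ?_
      filter_upwards [Ioo_mem_nhdsGT zero_lt_one] with t ht using (hLl t ht).symm
    · rw [hL1]
      refine (IsProfile.tendsto_halfWidth hp.r_one).congr' ?_
      filter_upwards [Ioo_mem_nhdsLT zero_lt_one] with t ht using (hLl t ht).symm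
  have hpos : ∀ t ∈ Ico (0 : ℝ) 1, 0 < r t := fun t ht => by
    rcases ht.1.eq_or_lt with rfl | ht0
    · exact hp.pos_zero
    · exact hq.pos t ⟨ht0, ht.2⟩
  have hcurve : ∀ t ∈ Icc (0 : ℝ) 1,
      (regularizedPair η r a k).curve t = bumpMeasure.map (L t * ·) := by
    intro t _
    by_cases ht : t ∈ Ico (0 : ℝ) 1
    · have h1 := hpos t ht
      rw [hLl' t ht, ← withDensity_rescaled_bump (R := r t)
        (by unfold halfWidth; positivity) (by unfold halfWidth; field_simp)]
      exact if_pos ht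
    · rw [show L t = 0 from if_neg ht, map_zero_mul_bumpMeasure]
      exact if_neg ht
  refine hq.isUniqueMinimizer hr (hq.admissibleEta hr hL hLl hL1 hcurve rfl hbeta)
    (fun d hd => ⟨hd, ?_⟩) rfl hbeta
  have hm : Tendsto d.moment (𝓝[>] 0) (𝓝 (d.moment 0)) :=
    (hd.continuousOn_moment 0 ⟨le_rfl, zero_le_one⟩).tendsto.mono_left
      (nhdsWithin_le_of_mem (Icc_mem_nhdsGT zero_lt_one))
  have h := hk0.add ((ha0.mul hm).const_mul (1 / 2))
  -- The boundary term `½ a(0) m(0)` with `a(0) = 1/η` is exactly the penalization.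
  have e : energyEta η d - energy d = 0 + 1 / 2 * (1 / η * d.moment 0) := by
    rw [energyEta, add_sub_cancel_left, integral_div, Pair.moment]
    ring
  rwa [e]

/-! ### Existence of profiles: cycloids -/

/-- The derivative `1 - cos θ` vanishes at the multiples of `2π`; strictness comes from `|sin h| <
h` for `h > 0` instead. -/
theorem strictMono_sub_sin : StrictMono fun θ : ℝ => θ - Real.sin θ := by
  intro x y hxy
  have h1 : Real.sin y - Real.sin x = 2 * Real.sin ((y - x) / 2) * Real.cos ((y + x) / 2) :=
    Real.sin_sub_sin y x
  have h2 : |Real.sin ((y - x) / 2)| < (y - x) / 2 := by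
    have h3 : 0 < (y - x) / 2 := by linarith
    rw [← abs_of_pos h3]
    simpa [abs_of_pos h3] using Real.abs_sin_lt_abs h3.ne'
  have h4 : Real.sin y - Real.sin x ≤ 2 * |Real.sin ((y - x) / 2)| := by
    rw [h1]
    refine (le_abs_self _).trans ?_
    rw [abs_mul, abs_mul, abs_two]
    exact mul_le_of_le_one_right (by positivity) (Real.abs_cos_le_one _)
  simp only
  linarith

theorem one_sub_cos_pos {θ : ℝ} (h0 : 0 < θ) (h1 : θ < 2 * Real.pi) : 0 < 1 - Real.cos θ := by
  refine sub_pos.2 ((Real.cos_le_one θ).lt_of_ne fun h => ?_)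
  exact h0.ne' ((Real.cos_eq_one_iff_of_lt_of_lt (by linarith [Real.pi_pos]) h1).1 h)

/-- The angle of a cycloid as a function of time. -/
theorem exists_cycloid_angle {θ₀ δ : ℝ} (h0 : 0 ≤ θ₀) (hδ : 0 < δ)
    (h : δ * (2 * Real.pi - θ₀ + Real.sin θ₀) = 1) :
    ∃ Θ : ℝ → ℝ, Continuous Θ ∧ Θ 0 = θ₀ ∧ Θ 1 = 2 * Real.pi ∧ (∀ t ∈ Ioo (0 : ℝ) 1,
      Θ t ∈ Ioo 0 (2 * Real.pi) ∧ HasDerivAt Θ (1 / (δ * (1 - Real.cos (Θ t)))) t) := by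
  set φ : ℝ → ℝ := fun θ => θ - Real.sin θ with hφ
  have hφc : Continuous φ := continuous_id.sub Real.continuous_sin
  have hsurj : Function.Surjective φ := by
    refine hφc.surjective ?_ ?_
    · refine tendsto_atTop_mono (fun θ => ?_) (tendsto_atTop_add_const_right _ (-1) tendsto_id)
      simp only [hφ, id]
      linarith [Real.sin_le_one θ]
    · refine tendsto_atBot_mono (fun θ => ?_) (tendsto_atBot_add_const_right _ 1 tendsto_id)
      simp only [hφ, id]
      linarith [Real.neg_one_le_sin θ]
  set e := strictMono_sub_sin.orderIsoOfSurjective φ hsurj with he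
  have heφ : ∀ y, φ (e.symm y) = y := fun y => e.apply_symm_apply y
  have hφe : ∀ y, e.symm (φ y) = y := fun y => e.symm_apply_apply y
  have hec : Continuous e.symm := e.symm.continuous
  -- This solves `δ(Θ - sin Θ) = δ(θ₀ - sin θ₀) + t`; the hypothesis `h` says that the arch ends, `Θ
  -- = 2π`, at time `1`.
  set Θ : ℝ → ℝ := fun t => e.symm (φ θ₀ + t / δ) with hΘ
  have hΘc : Continuous Θ := hec.comp (continuous_const.add (continuous_id.div_const δ))
  have hΘ0 : Θ 0 = θ₀ := by simp only [hΘ, zero_div, add_zero, hφe]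
  have hΘ1 : Θ 1 = 2 * Real.pi := by
    rw [← hφe (2 * Real.pi)]
    simp only [hΘ]
    congr 1
    simp only [hφ, Real.sin_two_pi, sub_zero]
    field_simp
    linarith
  have hmono : StrictMono Θ := fun s t hst => by
    refine e.symm.strictMono ?_
    have := div_lt_div_of_pos_right hst hδ
    linarith
  refine ⟨Θ, hΘc, hΘ0, hΘ1, fun t ht => ?_⟩
  have hm : Θ t ∈ Ioo 0 (2 * Real.pi) :=
    ⟨h0.trans_lt (hΘ0 ▸ hmono ht.1), hΘ1 ▸ hmono ht.2⟩
  refine ⟨hm, ?_⟩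
  have hc := one_sub_cos_pos hm.1 hm.2
  have h1 : HasDerivAt e.symm (1 - Real.cos (Θ t))⁻¹ (φ θ₀ + t / δ) :=
    HasDerivAt.of_local_left_inverse hec.continuousAt
      ((hasDerivAt_id _).sub (Real.hasDerivAt_sin _)) hc.ne' (Eventually.of_forall heφ)
  have h2 : HasDerivAt (fun t => φ θ₀ + t / δ) (1 / δ) t :=
    ((hasDerivAt_id t).div_const δ).const_add _
  refine (h1.comp t h2).congr_deriv ?_
  field_simp

/-- Cycloids solve the profile equations. -/
theorem isProfile_cycloid {δ c θ₀ : ℝ} {Θ : ℝ → ℝ} (hδ : 0 < δ) (hc : 0 < c)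
    (hcδ : c ^ 3 = 3 / 2 * δ ^ 2) (hΘ : Continuous Θ) (hΘ1 : Θ 1 = 2 * Real.pi)
    (hd : ∀ t ∈ Ioo (0 : ℝ) 1,
      Θ t ∈ Ioo 0 (2 * Real.pi) ∧ HasDerivAt Θ (1 / (δ * (1 - Real.cos (Θ t)))) t) :
    IsProfile (fun t => 3 / (4 * c * (1 - Real.cos (Θ t))))
      (fun t => Real.sin (Θ t) / (δ * (1 - Real.cos (Θ t)) ^ 2))
      (fun t => 3 * δ / (4 * c) * (Θ t - θ₀)) := by
  -- Here `l = c(1 - cos Θ)` and `a = l'/l`. One finds `l² l'' = -c³/δ²`, so `hcδ` is exactly what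
  -- turns this into `-3/2`.
  have hpos : ∀ t ∈ Ioo (0 : ℝ) 1, 0 < 1 - Real.cos (Θ t) := fun t ht =>
    one_sub_cos_pos (hd t ht).1.1 (hd t ht).1.2
  have hcos : ∀ t ∈ Ioo (0 : ℝ) 1, HasDerivAt (fun t => 1 - Real.cos (Θ t))
      (Real.sin (Θ t) * (1 / (δ * (1 - Real.cos (Θ t))))) t := fun t ht =>
    (((hd t ht).2.cos).const_sub 1).congr_deriv (by ring)
  refine ⟨fun t ht => ?_, fun t ht => ?_, fun t ht => ?_, fun t ht => ?_, ?_⟩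
  · have := hpos t ht
    positivity
  · have h1 := (hpos t ht).ne'
    refine (((hd t ht).2.sub_const θ₀).const_mul _).congr_deriv ?_
    field_simp
  · have h1 := (hpos t ht).ne'
    refine ((hasDerivAt_const t 3).div ((hcos t ht).const_mul (4 * c)) (by positivity)).congr_deriv ?_
    field_simp
    ring
  · have h1 := (hpos t ht).ne'
    have h2 := Real.sin_sq_add_cos_sq (Θ t)
    refine (((hd t ht).2.sin).div (((hcos t ht).fun_pow 2).const_mul δ) (by positivity)).congr_deriv ?_
    have h3 : 32 / 9 * (3 / (4 * c * (1 - Real.cos (Θ t)))) ^ 3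
        = 1 / (δ ^ 2 * (1 - Real.cos (Θ t)) ^ 3) := by
      rw [div_pow, mul_pow, mul_pow, hcδ]
      field_simp
      norm_num
    rw [h3]
    simp only [Nat.cast_ofNat, Nat.add_one_sub_one, pow_one]
    have h4 : Real.sin (Θ t) ^ 2 = (1 - Real.cos (Θ t)) * (1 + Real.cos (Θ t)) := by
      linear_combination h2
    field_simp
    rw [h4]
    ring
  · have h1 : Tendsto (fun t => 4 * c * (1 - Real.cos (Θ t))) (𝓝[<] 1) (𝓝[>] 0) := by
      refine tendsto_nhdsWithin_iff.2 ⟨?_, ?_⟩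
      · have h2 : Continuous fun t => 4 * c * (1 - Real.cos (Θ t)) := by fun_prop
        have h3 := h2.continuousAt.tendsto (x := (1 : ℝ))
        rw [hΘ1, Real.cos_two_pi, sub_self, mul_zero] at h3
        exact h3.mono_left nhdsWithin_le_nhds
      · filter_upwards [Ioo_mem_nhdsLT zero_lt_one] with t ht
        have := hpos t ht
        exact mem_Ioi.2 (by positivity)
    simpa only [div_eq_mul_inv, Function.comp_def] using
      (tendsto_inv_nhdsGT_zero.comp h1).const_mul_atTop (by norm_num : (0 : ℝ) < 3)

theorem exists_pow_three_eq {y : ℝ} (hy : 0 < y) : ∃ c : ℝ, 0 < c ∧ c ^ 3 = y :=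
  ⟨y ^ (1 / 3 : ℝ), by positivity, by
    rw [← Real.rpow_natCast, ← Real.rpow_mul hy.le]
    norm_num⟩

/-- A full arch, from angle `0` to `2π`, takes the time `2π δ`; hence `δ = 1/(2π)`. -/
theorem exists_isPlanningProfile : ∃ r a k : ℝ → ℝ, IsPlanningProfile r a k := by
  have hπ := Real.pi_pos
  have hδ : 0 < 1 / (2 * Real.pi) := by positivity
  obtain ⟨c, hc, hc3⟩ := exists_pow_three_eq (y := 3 / 2 * (1 / (2 * Real.pi)) ^ 2) (by positivity)
  obtain ⟨Θ, h1, h2, h3, h4⟩ := exists_cycloid_angle (θ₀ := 0) le_rfl hδ (by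
    rw [Real.sin_zero, sub_zero, add_zero]
    field_simp)
  refine ⟨_, _, _, isProfile_cycloid (θ₀ := 0) hδ hc hc3 h1 h3 h4, ?_, ?_⟩
  · have h5 : Tendsto (fun t => 4 * c * (1 - Real.cos (Θ t))) (𝓝[>] 0) (𝓝[>] 0) := by
      refine tendsto_nhdsWithin_iff.2 ⟨?_, ?_⟩
      · have h2' : Continuous fun t => 4 * c * (1 - Real.cos (Θ t)) := by fun_prop
        have h3 := h2'.continuousAt.tendsto (x := (0 : ℝ))
        rw [h2, Real.cos_zero, sub_self, mul_zero] at h3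
        exact h3.mono_left nhdsWithin_le_nhds
      · filter_upwards [Ioo_mem_nhdsGT zero_lt_one] with t ht
        have := one_sub_cos_pos (h4 t ht).1.1 (h4 t ht).1.2
        exact mem_Ioi.2 (by positivity)
    simpa only [div_eq_mul_inv, Function.comp_def] using
      (tendsto_inv_nhdsGT_zero.comp h5).const_mul_atTop (by norm_num : (0 : ℝ) < 3)
  · have h5 : Continuous fun t => 3 * (1 / (2 * Real.pi)) / (4 * c) * (Θ t - 0) := by fun_prop
    have h6 := h5.continuousAt.tendsto (x := (0 : ℝ))
    rw [h2, sub_zero, mul_zero] at h6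
    exact h6.mono_left nhdsWithin_le_nhds

/-- The initial angle that gives `a(0) = 1/η`. -/
theorem exists_initial_angle {η : ℝ} (hη : 0 < η) : ∃ θ : ℝ, 0 < θ ∧ θ ≤ Real.pi ∧
    η * (Real.sin θ * (2 * Real.pi - θ + Real.sin θ)) = (1 - Real.cos θ) ^ 2 := by
  have hπ := Real.pi_gt_three
  set f : ℝ → ℝ := fun θ =>
    η * (Real.sin θ * (2 * Real.pi - θ + Real.sin θ)) - (1 - Real.cos θ) ^ 2 with hf
  have hfc : Continuous f := by fun_prop
  -- At `θ₁` the left side is at least `2 θ₁²`, by `η ≥ θ₁`, `sin θ₁ ≥ 2 θ₁/π` and a last factor `≥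
  -- π`; the right side is at most `θ₁⁴/4`. At `π` the left side is `0` and the right side is `4`.
  set θ₁ := min 1 η with hθ₁
  have h0 : 0 < θ₁ := lt_min one_pos hη
  have h1 : θ₁ ≤ 1 := min_le_left _ _
  have h2 : θ₁ ≤ η := min_le_right _ _
  have hf1 : 0 ≤ f θ₁ := by
    have h3 : 2 / Real.pi * θ₁ ≤ Real.sin θ₁ := Real.mul_le_sin h0.le (by linarith)
    have hs : 0 ≤ Real.sin θ₁ := Real.sin_nonneg_of_nonneg_of_le_pi h0.le (by linarith)
    have h4 : Real.pi ≤ 2 * Real.pi - θ₁ + Real.sin θ₁ := by linarith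
    have h5 : 1 - Real.cos θ₁ ≤ θ₁ ^ 2 / 2 := by linarith [Real.one_sub_sq_div_two_le_cos (x := θ₁)]
    have h6 : 0 ≤ 1 - Real.cos θ₁ := by linarith [Real.cos_le_one θ₁]
    have h7 : θ₁ * (2 / Real.pi * θ₁ * Real.pi)
        ≤ η * (Real.sin θ₁ * (2 * Real.pi - θ₁ + Real.sin θ₁)) := by gcongr
    have h8 : (1 - Real.cos θ₁) ^ 2 ≤ (θ₁ ^ 2 / 2) ^ 2 := by gcongr
    have h9 : θ₁ * (2 / Real.pi * θ₁ * Real.pi) = 2 * θ₁ ^ 2 := by field_simp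
    have h10 : θ₁ ^ 2 ≤ 1 := pow_le_one₀ h0.le h1
    simp only [hf]
    nlinarith [sq_nonneg θ₁]
  have hf2 : f Real.pi ≤ 0 := by
    simp only [hf, Real.sin_pi, Real.cos_pi]
    norm_num
  obtain ⟨θ, hθ, h⟩ := intermediate_value_Icc' (by linarith : θ₁ ≤ Real.pi) hfc.continuousOn
    ⟨hf2, hf1⟩
  exact ⟨θ, h0.trans_le hθ.1, hθ.2, sub_eq_zero.1 h⟩

theorem exists_isRegularizedProfile {η : ℝ} (hη : 0 < η) :
    ∃ r a k : ℝ → ℝ, IsRegularizedProfile η r a k := by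
  have hπ := Real.pi_pos
  obtain ⟨θ₀, hθ, hθ', heq⟩ := exists_initial_angle hη
  have hsin : 0 ≤ Real.sin θ₀ := Real.sin_nonneg_of_nonneg_of_le_pi hθ.le hθ'
  have hD : 0 < 2 * Real.pi - θ₀ + Real.sin θ₀ := by linarith
  set δ := 1 / (2 * Real.pi - θ₀ + Real.sin θ₀) with hδdef
  have hδ : 0 < δ := by positivity
  obtain ⟨c, hc, hc3⟩ := exists_pow_three_eq (y := 3 / 2 * δ ^ 2) (by positivity)
  obtain ⟨Θ, h1, h2, h3, h4⟩ := exists_cycloid_angle (θ₀ := θ₀) hθ.le hδ (by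
    rw [hδdef]
    field_simp)
  have hcos0 := one_sub_cos_pos hθ (by linarith)
  have hne : ∀ t ∈ Ico (0 : ℝ) 1, 1 - Real.cos (Θ t) ≠ 0 := fun t ht => by
    rcases ht.1.eq_or_lt with rfl | ht0
    · rw [h2]
      exact hcos0.ne'
    · have := (h4 t ⟨ht0, ht.2⟩).1
      exact (one_sub_cos_pos this.1 this.2).ne'
  refine ⟨_, _, _, isProfile_cycloid (θ₀ := θ₀) hδ hc hc3 h1 h3 h4, ?_, ?_, ?_, ?_, ?_, ?_⟩
  · simp only [h2]
    positivity
  · refine continuousOn_const.div (by fun_prop) fun t ht => ?_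
    have := hne t ht
    positivity
  · refine ContinuousOn.div (by fun_prop) (by fun_prop) fun t ht => ?_
    have := hne t ht
    positivity
  · fun_prop
  · simp only [h2]
    rw [← heq, hδdef]
    -- This excludes `θ₀ = π`, where `a(0)` would be `0`.
    have hs : Real.sin θ₀ ≠ 0 := fun h => by
      rw [h, zero_mul, mul_zero] at heq
      exact (pow_pos hcos0 2).ne heq
    field_simp
  · simp only [h2, sub_self, mul_zero]

end Planning

end

theorem mainTheorem3 :
    (∀ η : ℝ, 0 < η →
      (∃ r a k : ℝ → ℝ, Planning.IsRegularizedProfile η r a k) ∧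
      ∀ r a k : ℝ → ℝ, Planning.IsRegularizedProfile η r a k →
        Planning.IsUniqueMinimizer Planning.AdmissibleEta (Planning.energyEta η)
          (Planning.regularizedPair η r a k)) ∧
    ((∃ r a k : ℝ → ℝ, Planning.IsPlanningProfile r a k) ∧
      ∀ r a k : ℝ → ℝ, Planning.IsPlanningProfile r a k →
        Planning.IsUniqueMinimizer Planning.Admissible Planning.energy
          (Planning.planningPair r a k)) :=
  ⟨fun _ hη => ⟨Planning.exists_isRegularizedProfile hη, fun _ _ _ h => h.isUniqueMinimizer⟩,
    Planning.exists_isPlanningProfile, fun _ _ _ h => h.isUniqueMinimizer⟩
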